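/- Let $\hat\Gamma$ be a finite extensive-form game with players $1,\dots,n$, perfect recall, and utilities in $[0,1]$, and let $\hat u_0:\hat Z\to[0,1]$ be a mediator's objective on its terminal nodes. Let $\Gamma$ be the mediator-augmented game: before each decision of a player the mediator (player $0$, who has perfect information and objective $u_0$ induced by $\hat u_0$) recommends a legal action, which only this player sees before choosing; players remember their own past observations and actions; once two players have disobeyed a recommendation, no further recommendations are given. Let $Z$ be the set of terminal nodes of $\Gamma$. For a player $i$ (or the mediator, $i=0$) let $\Sigma_i$ be the set of sequences $\sigma_i(z)$, $z\in Z$ (the information sets and actions of $i$ on the path to $z$), let $X_i\subset[0,1]^{\Sigma_i}$ be its polytope of sequence-form mixed strategies, and write $x_i[z]=x_i[\sigma_i(z)]$, $X=X_1\times\dots\times X_n$ and $\hat x[z]=\prod_{i=1}^n x_i[z]$. Let $d=(d_1,\dots,d_n)$ be the sequence form of a profile of pure strategies that follow all recommendations. A strategy $\mu\in X_0$ is an equilibrium if $u_i(\mu,x_i,d_{-i})\le u_i(\mu,d)$ for all $i\in\{1,\dots,n\}$ and $x_i\in X_i$, and is optimal if it maximizes $u_0(\mu,d)$ among the equilibria;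 let $u_0^*$ be this maximum. Call $\lambda^*\ge 1$ a threshold if for every $\lambda\ge\lambda^*$ the solutions $\mu$ of $$\max_{\mu\in X_0}\ \min_{x\in X}\ u_0(\mu,d)-\lambda\sum_{i=1}^n\bigl[u_i(\mu,x_i,d_{-i})-u_i(\mu,d)\bigr]$$ are exactly the optimal equilibria. **Algorithm OnlineSteer** (hyperparameters $\alpha,\lambda$). In each round $t=1,\dots,T$ the mediator plays the strategy $\mu^{(t)}\in X_0$ returned by a regret minimizer, which has seen only the utility functions passed to it in earlier rounds, and offers each player $i$ the payment $$p_i^{(t)}(x)=\alpha\, d_i^\top x_i+\bigl[u_i(\mu^{(t)},x_i,d_{-i})-u_i(\mu^{(t)},x)\bigr]-\min_{x_i'\in X_i}\bigl[u_i(\mu^{(t)},x_i',d_{-i})-u_i(\mu^{(t)},x_i',x_{-i})\bigr].$$ The players choose $x^{(t)}\in X$ in any way. The utility function $\mu\mapsto\frac1\lambda u_0(\mu,d)-\sum_{i=1}^n[u_i(\mu,x_i^{(t)},d_{-i})-u_i(\mu,d)]$ is passed to the regret minimizer. Suppose that after $T$ rounds the regret minimizer has regret at most $R_0(T)$ on the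 utility functions passed to it, and that each player $i$ has normalized regret $$\frac1{P+1}\Bigl[\max_{x_i^*\in X_i}\sum_{t=1}^T v_i^{(t)}(x_i^*)-\sum_{t=1}^T v_i^{(t)}(x_i^{(t)})\Bigr]\le R(T),\qquad v_i^{(t)}(x_i)=u_i(\mu^{(t)},x_i,x^{(t)}_{-i})+p_i^{(t)}(x_i,x^{(t)}_{-i}),$$ where $P=3$ is the bound on the payments. **Theorem.** Optimal equilibria and thresholds $\lambda^*\ge1$ exist. For every threshold $\lambda^*\ge 1$: let $\epsilon=(R_0(T)+4nR(T))/T>0$, set $\alpha=\epsilon^{2/3}|Z|^{-1/3}$ and $\lambda=|Z|^{2/3}\epsilon^{-1/3}$, and let $T$ be such that $\alpha\le 1/|Z|$. Then in every run of OnlineSteer as above the average realized payment $\frac1T\sum_{t=1}^T p_i^{(t)}(x^{(t)})$ to each player $i$, the directness gap $\sum_{z\in Z}\bigl|\frac1T\sum_{t=1}^T\hat x^{(t)}[z]-\hat d[z]\bigr|$, and the optimality gap $u_0^*-\frac1T\sum_{t=1}^T u_0(\mu^{(t)},x^{(t)})$ are all at most $$7\lambda^*|Z|^{4/3}\epsilon^{1/3}.$$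 -/

import Mathlib

noncomputable section

/-! ### Finite extensive-form games -/

/-- A finite game tree with information sets (labels) in `I`, legal actions `A J` at every node of the
information set `J`, and a payoff to every member of `P` at every leaf.  Nodes of the tree are nature's
moves (with a fixed probability distribution) or decision nodes, which carry their information set. -/
inductive GameTree (I : Type) (A : I → Type) (P : Type) : Type where
  | leaf (u : P → ℝ) : GameTree I A P
  | chance {k : ℕ} (p : stdSimplex ℝ (Fin k)) (next : Fin k → GameTree I A P) : GameTree I A P
  | decision (J : I) (next : A J → GameTree I A P) : GameTree I A P

namespace GameTree

/-- The terminal nodes of a tree (as root-to-leaf paths). -/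
def Leaf {I : Type} {A : I → Type} {P : Type} : GameTree I A P → Type
  | leaf _ => Unit
  | @chance _ _ _ k _ next => (c : Fin k) × Leaf (next c)
  | decision J next => (a : A J) × Leaf (next a)

@[reducible] def leafFintype {I : Type} {A : I → Type} {P : Type} [∀ J, Fintype (A J)] :
    (t : GameTree I A P) → Fintype t.Leaf
  | leaf _ => inferInstanceAs (Fintype Unit)
  | @chance _ _ _ k _ next =>
      have : ∀ c, Fintype (next c).Leaf := fun c => leafFintype (next c)
      inferInstanceAs (Fintype ((c : Fin k) × (next c).Leaf))
  | decision J next =>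
      have : ∀ a, Fintype (next a).Leaf := fun a => leafFintype (next a)
      inferInstanceAs (Fintype ((a : A J) × (next a).Leaf))

instance {I : Type} {A : I → Type} {P : Type} [∀ J, Fintype (A J)] (t : GameTree I A P) :
    Fintype t.Leaf := leafFintype t

/-- The payoff vector at a terminal node. -/
def payoff {I : Type} {A : I → Type} {P : Type} : (t : GameTree I A P) → t.Leaf → P → ℝ
  | leaf u, _ => u
  | chance _ next, z => payoff (next z.1) z.2
  | decision _ next, z => payoff (next z.1) z.2

/-- The probability that all of nature's moves on the path to a terminal node are made. -/
def chanceProb {I : Type} {A : I → Type} {P : Type} : (t : GameTree I A P) → t.Leaf → ℝ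
  | leaf _, _ => 1
  | chance p next, z => p.1 z.1 * chanceProb (next z.1) z.2
  | decision _ next, z => chanceProb (next z.1) z.2

open Classical in
/-- The sequence `σᵢ(z)` of player `i` at a terminal node: the information sets of `i` encountered on the
path to `z` and the actions taken there.  It is recorded in the order of play (under perfect recall the
order is determined by the set). -/
def sequence {I : Type} {A : I → Type} {P : Type} (owner : I → P) (i : P) :
    (t : GameTree I A P) → t.Leaf → List ((J : I) × A J)
  | leaf _, _ => []
  | chance _ next, z => sequence owner i (next z.1) z.2
  | decision J next, z =>
      if owner J = i then ⟨J, z.1⟩ :: sequence owner i (next z.1) z.2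
      else sequence owner i (next z.1) z.2

open Classical in
/-- The pairs `(J, σᵢ(h))` for the decision nodes `h` of player `i` in the tree, where `J` is the
information set of `h` and `r` is the sequence of `i` at the root of the tree. -/
def records {I : Type} {A : I → Type} {P : Type} (owner : I → P) (i : P) :
    GameTree I A P → List ((J : I) × A J) → Set (I × List ((J : I) × A J))
  | leaf _, _ => ∅
  | chance _ next, r => ⋃ c, records owner i (next c) r
  | decision J next, r =>
      if owner J = i then {(J, r)} ∪ ⋃ a, records owner i (next a) (r ++ [⟨J, a⟩])
      else ⋃ a, records owner i (next a) r

end GameTree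

/-- A finite extensive-form game with player set `P`. -/
structure EFG (P : Type) where
  /-- the information sets of all players -/
  Infoset : Type
  /-- the player to whom an information set belongs -/
  owner : Infoset → P
  /-- the legal actions at an information set -/
  Act : Infoset → Type
  [actFintype : ∀ J, Fintype (Act J)]
  [actNonempty : ∀ J, Nonempty (Act J)]
  /-- the tree -/
  tree : GameTree Infoset Act P

namespace EFG

attribute [instance] EFG.actFintype EFG.actNonempty

/-- The set `Z` of terminal nodes. -/
abbrev Z {P : Type} (G : EFG P) : Type := G.tree.Leaf

/-- The utility `uᵢ(z)`. -/
def payoff {P : Type} (G : EFG P) (i : P) (z : G.Z) : ℝ := G.tree.payoff z i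

/-- The sequence `σᵢ(z)`. -/
def seq {P : Type} (G : EFG P) (i : P) (z : G.Z) : List ((J : G.Infoset) × G.Act J) :=
  G.tree.sequence G.owner i z

/-- Perfect recall of player `i`: its sequence is the same at all nodes of an information set. -/
def PerfectRecall {P : Type} (G : EFG P) (i : P) : Prop :=
  ∀ (J : G.Infoset) (r r' : List ((J : G.Infoset) × G.Act J)),
    (J, r) ∈ G.tree.records G.owner i [] → (J, r') ∈ G.tree.records G.owner i [] → r = r'

/-- The set `Σᵢ` of terminal sequences of player `i`. -/
abbrev Seqs {P : Type} (G : EFG P) (i : P) : Type := Set.range (G.seq i)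

instance {P : Type} (G : EFG P) (i : P) : Fintype (G.Seqs i) := Fintype.ofFinite _

/-- Vectors indexed by `Σᵢ`. -/
abbrev Vec {P : Type} (G : EFG P) (i : P) : Type := G.Seqs i → ℝ

/-- `xᵢ[z] := xᵢ[σᵢ(z)]`. -/
def at' {P : Type} (G : EFG P) {i : P} (x : G.Vec i) (z : G.Z) : ℝ := x ⟨G.seq i z, z, rfl⟩

/-- A pure strategy of player `i`: an action at each information set of `i`. -/
abbrev Pure {P : Type} (G : EFG P) (i : P) : Type := (J : {J : G.Infoset // G.owner J = i}) → G.Act J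

open Classical in
/-- The sequence form of a pure strategy: `x[σ] = 1` if the strategy plays all actions of `σ`. -/
def seqForm {P : Type} (G : EFG P) {i : P} (s : G.Pure i) : G.Vec i := fun σ =>
  if ∀ (J : G.Infoset) (a : G.Act J) (h : G.owner J = i), ⟨J, a⟩ ∈ σ.1 → s ⟨J, h⟩ = a then 1 else 0

/-- The polytope `Xᵢ` of sequence-form mixed strategies. -/
def X {P : Type} (G : EFG P) (i : P) : Set (G.Vec i) := convexHull ℝ (Set.range (G.seqForm (i := i)))

/-- The expected utility `uᵢ(x)` of player `i` under the profile `x`. -/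
def u {P : Type} [Fintype P] (G : EFG P) (i : P) (x : (j : P) → G.Vec j) : ℝ :=
  ∑ z : G.Z, (G.tree.chanceProb z * ∏ j, G.at' (x j) z) * G.payoff i z

end EFG

/-! ### The mediator-augmented game -/

/-- Information sets of the augmented game: singletons for the mediator, each carrying the complete history
of its node (nature's moves, advice and actions; perfect information), and, for the players, an information
set `J` of the original game together with the player's own earlier information sets, recommendations
(`none`: no recommendation was given) and actions, and the current recommendation. -/
inductive AugInfoset (I : Type) (A : I → Type) : Type where
  | mediator (history : List (ℕ ⊕ ((J : I) × A J))) (J : I) : AugInfoset I A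
  | player (J : I) (past : List ((K : I) × (Option (A K) × A K))) (advice : Option (A J)) :
      AugInfoset I A

namespace AugInfoset

/-- The information set of the original game that lies under one of the augmented game. -/
def base {I : Type} {A : I → Type} : AugInfoset I A → I
  | mediator _ J => J
  | player J _ _ => J

/-- Player `none` is the mediator. -/
def owner {I : Type} {A : I → Type} {P : Type} (o : I → P) : AugInfoset I A → Option P
  | mediator _ _ => none
  | player J _ _ => some (o J)

end AugInfoset

open Classical in
/-- The tree of the augmented game.  `obj` is the mediator's objective, `h` the history so far, `past` the
private record of each player, and `D` the set of players who have disobeyed a recommendation.  As long as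
fewer than two players have disobeyed, every decision of a player is preceded by a recommendation, chosen by
the mediator and shown to this player only; afterwards no recommendations are given. -/
def augmentTree {I : Type} {A : I → Type} {P : Type} (owner : I → P) :
    (t : GameTree I A P) → (t.Leaf → ℝ) → List (ℕ ⊕ ((J : I) × A J)) →
    (P → List ((K : I) × (Option (A K) × A K))) → Finset P →
    GameTree (AugInfoset I A) (fun J => A J.base) (Option P)
  | .leaf v, obj, _, _, _ => .leaf (fun i => i.elim (obj ()) v)
  | .chance p next, obj, h, past, D =>
      .chance p fun c => augmentTree owner (next c) (fun z => obj ⟨c, z⟩) (h ++ [.inl c.1]) past D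
  | .decision J next, obj, h, past, D =>
      if D.card < 2 then
        .decision (.mediator h J) fun (r : A J) =>
          .decision (.player J (past (owner J)) (some r)) fun (a : A J) =>
            augmentTree owner (next a) (fun z => obj ⟨a, z⟩) (h ++ [.inr ⟨J, r⟩, .inr ⟨J, a⟩])
              (Function.update past (owner J) (past (owner J) ++ [⟨J, some r, a⟩]))
              (if a = r then D else insert (owner J) D)
      else
        .decision (.player J (past (owner J)) none) fun (a : A J) =>
          augmentTree owner (next a) (fun z => obj ⟨a, z⟩) (h ++ [.inr ⟨J, a⟩])
            (Function.update past (owner J) (past (owner J) ++ [⟨J, none, a⟩])) D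

namespace EFG

/-- The mediator-augmented game of `G` for the objective `obj`; player `none` is the mediator. -/
def augment {n : ℕ} (G : EFG (Fin n)) (obj : G.Z → ℝ) : EFG (Option (Fin n)) where
  Infoset := AugInfoset G.Infoset G.Act
  owner := AugInfoset.owner G.owner
  Act := fun J => G.Act J.base
  actFintype := fun J => G.actFintype J.base
  actNonempty := fun J => G.actNonempty J.base
  tree := augmentTree G.owner G.tree obj [] (fun _ => []) ∅

/-- A pure strategy of player `i` of the augmented game is direct if it follows every recommendation
(what it does where no recommendation is given is unrestricted). -/
def IsDirect {n : ℕ} (G : EFG (Fin n)) (obj : G.Z → ℝ) {i : Fin n}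
    (s : (G.augment obj).Pure (some i)) : Prop :=
  ∀ (J : G.Infoset) (past : List ((K : G.Infoset) × (Option (G.Act K) × G.Act K))) (a : G.Act J)
    (h : AugInfoset.owner G.owner (AugInfoset.player J past (some a)) = some i),
    s ⟨AugInfoset.player J past (some a), h⟩ = a

/-! ### Games with a mediator (player `none`) and players `0, …, n - 1` -/

/-- Strategy profiles (as vectors) of the players other than the mediator. -/
abbrev Profile {n : ℕ} (Γ : EFG (Option (Fin n))) : Type := (i : Fin n) → Γ.Vec (some i)

/-- The set `X = X₁ × ⋯ × Xₙ`. -/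
def XX {n : ℕ} (Γ : EFG (Option (Fin n))) : Set Γ.Profile := {x | ∀ i, x i ∈ Γ.X (some i)}

/-- The utility `u_k(μ, x)`, that is, the utility of `k` under `x` in the game `Γ^μ`. -/
def um {n : ℕ} (Γ : EFG (Option (Fin n))) (k : Option (Fin n)) (μ : Γ.Vec none) (x : Γ.Profile) : ℝ :=
  Γ.u k (fun j => match j with
    | none => μ
    | some i => x i)

/-- `x̂[z] = ∏ᵢ xᵢ[z]`, the product over the players other than the mediator. -/
def hat {n : ℕ} (Γ : EFG (Option (Fin n))) (x : Γ.Profile) (z : Γ.Z) : ℝ := ∏ i, Γ.at' (x i) z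

/-- `μ` is a (Bayes-correlated) equilibrium: `d` is a Nash equilibrium of `Γ^μ`. -/
def IsEquilibrium {n : ℕ} (Γ : EFG (Option (Fin n))) (d : Γ.Profile) (μ : Γ.Vec none) : Prop :=
  μ ∈ Γ.X none ∧
    ∀ i, ∀ y ∈ Γ.X (some i), Γ.um (some i) μ (Function.update d i y) ≤ Γ.um (some i) μ d

/-- `μ` is an optimal equilibrium: it maximizes `u₀(μ, d)` among the equilibria. -/
def IsOptimal {n : ℕ} (Γ : EFG (Option (Fin n))) (d : Γ.Profile) (μ : Γ.Vec none) : Prop :=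
  Γ.IsEquilibrium d μ ∧ ∀ μ', Γ.IsEquilibrium d μ' → Γ.um none μ' d ≤ Γ.um none μ d

/-- `∑ᵢ [uᵢ(μ, xᵢ, d₋ᵢ) - uᵢ(μ, dᵢ, d₋ᵢ)]`. -/
def devGain {n : ℕ} (Γ : EFG (Option (Fin n))) (d : Γ.Profile) (μ : Γ.Vec none) (x : Γ.Profile) : ℝ :=
  ∑ i, (Γ.um (some i) μ (Function.update d i (x i)) - Γ.um (some i) μ d)

/-- `μ` solves the max-min problem
`max_{μ ∈ X₀} min_{x ∈ X} u₀(μ, d) - lam ∑ᵢ [uᵢ(μ, xᵢ, d₋ᵢ) - uᵢ(μ, dᵢ, d₋ᵢ)]`. -/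
def IsSaddleSolution {n : ℕ} (Γ : EFG (Option (Fin n))) (d : Γ.Profile) (lam : ℝ) (μ : Γ.Vec none) :
    Prop :=
  μ ∈ Γ.X none ∧
    IsMaxOn (fun μ => ⨅ x : Γ.XX, (Γ.um none μ d - lam * Γ.devGain d μ x)) (Γ.X none) μ

/-- For all `lam ≥ lamStar` the solutions of the max-min problem are exactly the optimal equilibria. -/
def IsLagrangeThreshold {n : ℕ} (Γ : EFG (Option (Fin n))) (d : Γ.Profile) (lamStar : ℝ) : Prop :=
  ∀ lam, lamStar ≤ lam → ∀ μ, Γ.IsSaddleSolution d lam μ ↔ Γ.IsOptimal d μ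

/-! ### Steering -/

/-- The `FullFeedbackSteer` payment `pᵢ(x)` in the game `Γ^μ`. -/
def payment {n : ℕ} (Γ : EFG (Option (Fin n))) (d : Γ.Profile) (α : ℝ) (μ : Γ.Vec none) (i : Fin n)
    (x : Γ.Profile) : ℝ :=
  α * (d i ⬝ᵥ x i)
    + (Γ.um (some i) μ (Function.update d i (x i)) - Γ.um (some i) μ x)
    - ⨅ y : Γ.X (some i),
        (Γ.um (some i) μ (Function.update d i y) - Γ.um (some i) μ (Function.update x i y))

/-- The utility `vᵢ(x)` of player `i` in `Γ^μ`, payments included. -/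
def paidUtility {n : ℕ} (Γ : EFG (Option (Fin n))) (d : Γ.Profile) (α : ℝ) (μ : Γ.Vec none) (i : Fin n)
    (x : Γ.Profile) : ℝ :=
  Γ.um (some i) μ x + Γ.payment d α μ i x

/-- The utility function passed to the mediator's regret minimizer after the players chose `x`. -/
def mediatorUtility {n : ℕ} (Γ : EFG (Option (Fin n))) (d : Γ.Profile) (lam : ℝ) (x : Γ.Profile)
    (μ : Γ.Vec none) : ℝ :=
  1 / lam * Γ.um none μ d - Γ.devGain d μ x

/-- A run of `OnlineSteer` over `T` rounds with the regret minimizer `alg`, which maps the list of the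
utility functions received so far to the mediator's next strategy.  The mediator plays `μ t`, the players
play `x t` (chosen in any manner whatsoever). -/
structure IsOnlineSteerRun {n : ℕ} (Γ : EFG (Option (Fin n))) (d : Γ.Profile) (lam : ℝ)
    (alg : List (Γ.Vec none → ℝ) → Γ.Vec none) (T : ℕ)
    (μ : ℕ → Γ.Vec none) (x : ℕ → Γ.Profile) : Prop where
  mediator_plays : ∀ t < T, μ t = alg (List.ofFn fun s : Fin t => Γ.mediatorUtility d lam (x s))
  mediator_mem : ∀ t < T, μ t ∈ Γ.X none
  players_mem : ∀ t < T, x t ∈ Γ.XX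

/-- The mediator's regret after `T` rounds, on the utilities passed to its regret minimizer, is at most
`r`. -/
def MediatorRegretLE {n : ℕ} (Γ : EFG (Option (Fin n))) (d : Γ.Profile) (lam : ℝ) (T : ℕ)
    (μ : ℕ → Γ.Vec none) (x : ℕ → Γ.Profile) (r : ℝ) : Prop :=
  ∀ μ' ∈ Γ.X none,
    ∑ t ∈ Finset.range T, Γ.mediatorUtility d lam (x t) μ'
      - ∑ t ∈ Finset.range T, Γ.mediatorUtility d lam (x t) (μ t) ≤ r

/-- The regret of player `i` after `T` rounds (payments included, normalized by `1 / (P + 1)`, where `P = 3`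
is the largest payment) is at most `r`. -/
def PlayerRegretLE {n : ℕ} (Γ : EFG (Option (Fin n))) (d : Γ.Profile) (α : ℝ) (T : ℕ)
    (μ : ℕ → Γ.Vec none) (x : ℕ → Γ.Profile) (i : Fin n) (r : ℝ) : Prop :=
  ∀ y ∈ Γ.X (some i),
    1 / (3 + 1 : ℝ) *
      (∑ t ∈ Finset.range T, Γ.paidUtility d α (μ t) i (Function.update (x t) i y)
        - ∑ t ∈ Finset.range T, Γ.paidUtility d α (μ t) i (x t)) ≤ r

/-- The average realized payment to player `i`. -/
def averagePayment {n : ℕ} (Γ : EFG (Option (Fin n))) (d : Γ.Profile) (α : ℝ) (T : ℕ)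
    (μ : ℕ → Γ.Vec none) (x : ℕ → Γ.Profile) (i : Fin n) : ℝ :=
  1 / (T : ℝ) * ∑ t ∈ Finset.range T, Γ.payment d α (μ t) i (x t)

/-- The directness gap. -/
def directnessGap {n : ℕ} (Γ : EFG (Option (Fin n))) (d : Γ.Profile) (T : ℕ) (x : ℕ → Γ.Profile) : ℝ :=
  ∑ z : Γ.Z, |1 / (T : ℝ) * ∑ t ∈ Finset.range T, Γ.hat (x t) z - Γ.hat d z|

/-- The optimality gap, relative to an optimal equilibrium `μStar`. -/
def optimalityGap {n : ℕ} (Γ : EFG (Option (Fin n))) (d : Γ.Profile) (μStar : Γ.Vec none) (T : ℕ)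
    (μ : ℕ → Γ.Vec none) (x : ℕ → Γ.Profile) : ℝ :=
  Γ.um none μStar d - 1 / (T : ℝ) * ∑ t ∈ Finset.range T, Γ.um none (μ t) (x t)

end EFG

end

/-! The payment replaces the opponents by obedient ones: up to a term that player `i` cannot
influence, `i` is paid as if the others played `d`, plus `α` times its own agreement with `d`.
Summing the players' regrets against a profile `y` and adding the mediator's regret against an
optimal equilibrium, the deviation gains of the actual play cancel, and those against the
equilibrium are nonpositive. With `A` the average of `deficit d (x t)` and `ν` the average mediator
strategy, `regret_tradeoff` obtains α (A - deficit d y) + devGain(ν, y) + (u₀* - u₀(ν, d)) / λ ≤ ε.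
Taking `y = d` bounds `A` once u₀(ν, d) is known not to exceed u₀* by much. Taking for `y` a best
response to `d` under `ν` bounds the incentive to deviate, and the threshold property turns this
into such a bound on u₀(ν, d). `steering_arithmetic` combines the two with κ = (ε|Z|)^(1/3), so that
α = κ²/|Z|, λ = |Z|/κ and ε = κ³/|Z|, giving A ≤ 5λ*κ. Each gap is at most about |Z| A, because
`deficit` dominates the change of every product of realization weights (`abs_seqForm_sub_le`,
`abs_prod_at'_sub_le`). If λ < 2λ*, the claimed bound exceeds the trivial one.

The delicate point is the term deficit d y. Counting the sequences of each player separately would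
only give n|Z|; what is needed is |Z|, for some best response. Where no recommendation is given, a
unilateral deviator never arrives, so the best response may agree with `d` there. A sequence of `i`
that is then lost contains an obeyed recommendation with an alternative action, and it is mapped to
a leaf with the same decisions of `i` at which `i` is the first to disobey. The leaf reveals the
player, and an obedient sequence can be rebuilt from its decisions, so the map is injective over all
players together (`exists_isBestResponse_deficit_le`).

Equilibria exist since a correlated equilibrium of the original game, obtained from Farkas' lemma in
the manner of Hart and Schmeidler, can be recommended by the mediator; perfect recall lets a
deviator be simulated in the original game. Optimal ones exist by compactness, and thresholds exist
because the equilibrium conditions form a finite linear system, for which the linear penalty is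
exact. -/

open Finset

/-! ### Linear inequalities -/

/-- **Farkas' lemma** for finitely many linear functionals. -/
theorem farkas_fin {W : Type*} [AddCommGroup W] [Module ℝ W] (m : ℕ) (f : Fin m → W →ₗ[ℝ] ℝ)
    (g : W →ₗ[ℝ] ℝ) (h : ∀ w, (∀ j, f j w ≤ 0) → g w ≤ 0) :
    ∃ c : Fin m → ℝ, (∀ j, 0 ≤ c j) ∧ ∀ w, g w = ∑ j, c j * f j w := by
  induction m generalizing g with
  | zero =>
    refine ⟨fun _ => 0, fun _ => le_rfl, fun w => ?_⟩
    have h₁ := h w (fun j => j.elim0)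
    have h₂ := h (-w) (fun j => j.elim0)
    rw [map_neg] at h₂
    simp only [univ_eq_empty, sum_empty]
    linarith
  | succ m ih =>
    by_cases h' : ∀ w, (∀ j : Fin m, f j.castSucc w ≤ 0) → g w ≤ 0
    · obtain ⟨c, hc, hg⟩ := ih (fun j => f j.castSucc) g h'
      refine ⟨Fin.snoc c 0, fun j => ?_, fun w => ?_⟩
      · refine Fin.lastCases ?_ (fun j => ?_) j <;> simp [hc]
      · simp [Fin.sum_univ_castSucc, hg]
    · push Not at h'
      obtain ⟨w₁, hw₁, hg₁⟩ := h'
      have hl : 0 < f (Fin.last m) w₁ := by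
        by_contra hl
        refine absurd (h w₁ fun j => ?_) (not_le.2 hg₁)
        exact Fin.lastCases (not_lt.1 hl) hw₁ j
      set l := f (Fin.last m) w₁
      set w₀ := l⁻¹ • w₁ with hw₀
      have hl₀ : f (Fin.last m) w₀ = 1 := by
        rw [hw₀, map_smul, smul_eq_mul]
        exact inv_mul_cancel₀ hl.ne'
      have hf₀ : ∀ j : Fin m, f j.castSucc w₀ ≤ 0 := fun j => by
        rw [hw₀, map_smul, smul_eq_mul]
        exact mul_nonpos_of_nonneg_of_nonpos (inv_nonneg.2 hl.le) (hw₁ j)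
      have hg₀ : 0 ≤ g w₀ := by
        rw [hw₀, map_smul, smul_eq_mul]
        exact mul_nonneg (inv_nonneg.2 hl.le) hg₁.le
      -- The projection along `w₀` onto the kernel of the last functional: there the last constraint
      -- holds automatically, so the induction hypothesis applies to the composites with `π`.
      let π : W →ₗ[ℝ] W := LinearMap.id - (f (Fin.last m)).smulRight w₀
      have hπ : ∀ w, π w = w - f (Fin.last m) w • w₀ := fun w => by simp [π]
      obtain ⟨c, hc, hg⟩ := ih (fun j => f j.castSucc ∘ₗ π) (g ∘ₗ π) fun w hw => by
        refine h _ fun j => ?_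
        refine Fin.lastCases ?_ hw j
        rw [hπ, map_sub, map_smul, hl₀]
        simp
      refine ⟨Fin.snoc c (g w₀ - ∑ j, c j * f j.castSucc w₀), fun j => ?_, fun w => ?_⟩
      · refine Fin.lastCases ?_ (fun j => ?_) j
        · have : ∑ j, c j * f j.castSucc w₀ ≤ 0 :=
            sum_nonpos fun j _ => mul_nonpos_of_nonneg_of_nonpos (hc j) (hf₀ j)
          simp only [Fin.snoc_last]
          linarith
        · simp [hc]
      · have := hg w
        simp only [LinearMap.comp_apply, hπ, map_sub, map_smul, smul_eq_mul, mul_sub,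
          sum_sub_distrib] at this
        have e : ∑ j, c j * (f (Fin.last m) w * f j.castSucc w₀)
            = f (Fin.last m) w * ∑ j, c j * f j.castSucc w₀ := by
          rw [mul_sum]
          exact sum_congr rfl fun j _ => by ring
        simp only [Fin.sum_univ_castSucc, Fin.snoc_castSucc, Fin.snoc_last]
        linarith

/-- **Farkas' lemma** over nonnegative weights. -/
theorem farkas_weights {V K : Type*} [Fintype V] [Fintype K] (H : K → V → ℝ) (b : V → ℝ)
    (h : ∀ w : V → ℝ, (∀ v, 0 ≤ w v) → (∀ k, ∑ v, w v * H k v ≤ 0) → ∑ v, w v * b v ≤ 0) :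
    ∃ c : K → ℝ, (∀ k, 0 ≤ c k) ∧ ∀ v, b v ≤ ∑ k, c k * H k v := by
  classical
  let dot : (V → ℝ) → (V → ℝ) →ₗ[ℝ] ℝ := fun a => ∑ v, a v • LinearMap.proj v
  have hdot : ∀ a w, dot a w = ∑ v, w v * a v := fun a w => by
    simp [dot, mul_comm]
  let F : V ⊕ K → (V → ℝ) →ₗ[ℝ] ℝ := Sum.elim (fun v => - LinearMap.proj v) (fun k => dot (H k))
  let e := Fintype.equivFin (V ⊕ K)
  obtain ⟨c, hc, hg⟩ := farkas_fin _ (fun j => F (e.symm j)) (dot b) fun w hw => by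
    have hw' : ∀ j, F j w ≤ 0 := fun j => by simpa using hw (e j)
    rw [hdot]
    refine h w (fun v => ?_) fun k => ?_
    · simpa [F] using hw' (.inl v)
    · simpa [F, hdot] using hw' (.inr k)
  refine ⟨fun k => c (e (.inr k)), fun k => hc _, fun v => ?_⟩
  have hv := hg (Pi.single v 1)
  have hs : ∀ a : V → ℝ, ∑ u, (Pi.single v 1 : V → ℝ) u * a u = a v := fun a => by
    simp [Pi.single_apply]
  rw [hdot, hs, ← e.sum_comp, Fintype.sum_sum_type] at hv
  simp only [Equiv.symm_apply_apply, F, Sum.elim_inl, Sum.elim_inr, hdot, hs,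
    LinearMap.neg_apply, LinearMap.proj_apply] at hv
  have : ∑ u, c (e (.inl u)) * -(Pi.single v 1 : V → ℝ) u ≤ 0 := by
    refine sum_nonpos fun u _ => mul_nonpos_of_nonneg_of_nonpos (hc _) ?_
    by_cases huv : u = v
    · subst huv; simp
    · simp [huv]
  linarith

/-- **Ville's theorem** of the alternative. -/
theorem exists_weights_or_exists_multipliers {V K : Type*} [Fintype V] [Fintype K]
    (H : K → V → ℝ) :
    (∃ w : V → ℝ, (∀ v, 0 ≤ w v) ∧ ∑ v, w v = 1 ∧ ∀ k, ∑ v, w v * H k v ≤ 0) ∨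
      ∃ c : K → ℝ, (∀ k, 0 ≤ c k) ∧ ∀ v, 1 ≤ ∑ k, c k * H k v := by
  by_cases h : ∃ w : V → ℝ, (∀ v, 0 ≤ w v) ∧ ∑ v, w v = 1 ∧ ∀ k, ∑ v, w v * H k v ≤ 0
  · exact .inl h
  refine .inr (farkas_weights H (fun _ => 1) fun w hw hk => ?_)
  by_contra hpos
  simp only [mul_one, not_le] at hpos
  refine h ⟨fun v => (∑ u, w u)⁻¹ * w v, fun v => by have := hw v; positivity, ?_, fun k => ?_⟩
  · rw [← mul_sum, inv_mul_cancel₀ hpos.ne']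
  · simp only [mul_assoc, ← mul_sum]
    exact mul_nonpos_of_nonneg_of_nonpos (inv_nonneg.2 hpos.le) (hk k)

/-! ### Stationary distributions and correlated equilibria -/

/-- A nonnegative combination of self-maps of a finite set has a stationary distribution. -/
theorem exists_stationary {S K : Type*} [Fintype S] [Nonempty S] [Fintype K] (c : K → ℝ)
    (hc : ∀ k, 0 ≤ c k) (φ : K → S → S) :
    ∃ q : S → ℝ, (∀ s, 0 ≤ q s) ∧ ∑ s, q s = 1 ∧
      ∀ f : S → ℝ, ∑ s, q s * ∑ k, c k * (f (φ k s) - f s) = 0 := by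
  classical
  let ind : S → S → ℝ := fun r s => if s = r then 1 else 0
  have hf : ∀ (f : S → ℝ) s, ∑ r, f r * ind r s = f s := fun f s => by simp [ind]
  let H : S → S → ℝ := fun r s => ∑ k, c k * (ind r (φ k s) - ind r s)
  have hH : ∀ (f : S → ℝ) s, ∑ r, f r * H r s = ∑ k, c k * (f (φ k s) - f s) := fun f s => by
    simp only [H, mul_sum]
    rw [sum_comm]
    refine sum_congr rfl fun k _ => ?_
    rw [← hf f (φ k s), ← hf f s, ← sum_sub_distrib, mul_sum]
    refine sum_congr rfl fun r _ => by ring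
  rcases exists_weights_or_exists_multipliers H with ⟨q, hq, hq1, hqH⟩ | ⟨f, -, hf1⟩
  · refine ⟨q, hq, hq1, fun f => ?_⟩
    -- The columns of `H` sum to zero, so the nonpositive averages `∑ s, q s * H r s` add up to zero
    -- and each of them vanishes.
    have hz : ∑ r, ∑ s, q s * H r s = 0 := by
      rw [sum_comm]
      refine sum_eq_zero fun s _ => ?_
      rw [← mul_sum]
      have := hH (fun _ => 1) s
      simp only [one_mul, sub_self, mul_zero, sum_const_zero] at this
      rw [this, mul_zero]
    have hz' := (sum_eq_zero_iff_of_nonpos fun r _ => hqH r).1 hz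
    simp only [← hH, mul_sum]
    rw [sum_comm]
    refine sum_eq_zero fun r _ => ?_
    have := hz' r (mem_univ r)
    calc ∑ s, q s * (f r * H r s) = f r * ∑ s, q s * H r s := by
          rw [mul_sum]; exact sum_congr rfl fun s _ => by ring
      _ = 0 := by rw [this, mul_zero]
  -- The other alternative fails at a maximizer of `f`, where no self-map can increase `f`.
  · obtain ⟨s, hs⟩ := Finite.exists_max f
    have := hf1 s
    rw [hH] at this
    have h' : ∑ k, c k * (f (φ k s) - f s) ≤ 0 :=
      sum_nonpos fun k _ => mul_nonpos_of_nonneg_of_nonpos (hc k) (sub_nonpos.2 (hs _))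
    linarith

/-- Existence of correlated equilibria, for deviations `φ k` of the players `o k`. -/
theorem exists_correlated_equilibrium {ι S K : Type*} [Fintype ι] [DecidableEq ι] [Fintype S]
    [Nonempty S] [Fintype K] (o : K → ι) (φ : K → S → S) (V : ι → (ι → S) → ℝ) :
    ∃ w : (ι → S) → ℝ, (∀ p, 0 ≤ w p) ∧ ∑ p, w p = 1 ∧
      ∀ k, ∑ p, w p * (V (o k) (Function.update p (o k) (φ k (p (o k)))) - V (o k) p) ≤ 0 := by
  classical
  refine (exists_weights_or_exists_multipliers _).resolve_right ?_
  -- Hart–Schmeidler: if no correlated equilibrium exists, there are multipliers making the total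
  -- weighted gain at least 1 at every profile. Under the product of the players' stationary
  -- distributions for these multipliers the expected gain is 0.
  rintro ⟨c, hc, hc1⟩
  choose q hq hq1 hqf using fun i =>
    exists_stationary (fun k : {k // o k = i} => c k) (fun k => hc k) (fun k => φ k)
  have hw : ∀ p : ι → S, 0 ≤ ∏ i, q i (p i) := fun p => prod_nonneg fun i _ => hq i _
  have hw1 : ∑ p : ι → S, ∏ i, q i (p i) = 1 := by
    rw [← Fintype.prod_sum]
    simp [hq1]
  have hz : ∀ i, ∑ p : ι → S, (∏ j, q j (p j)) *
      ∑ k : {k // o k = i}, c k * (V i (Function.update p i (φ k (p i))) - V i p) = 0 := by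
    intro i
    -- With the other coordinates `r` fixed, the inner sum is the stationarity of `q i` for a
    -- function of the `i`-th coordinate.
    rw [← (Equiv.funSplitAt i S).symm.sum_comp, Fintype.sum_prod_type_right]
    refine sum_eq_zero fun r _ => ?_
    have hu : ∀ a b, Function.update ((Equiv.funSplitAt i S).symm (a, r)) i b
        = (Equiv.funSplitAt i S).symm (b, r) := fun a b => by
      ext j
      by_cases hj : j = i
      · subst hj; simp [Equiv.funSplitAt]
      · simp [hj, Equiv.funSplitAt]
    have hi : ∀ a, (Equiv.funSplitAt i S).symm (a, r) i = a := fun a => by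
      simp [Equiv.funSplitAt]
    have hj : ∀ a, ∏ j ∈ univ.erase i, q j ((Equiv.funSplitAt i S).symm (a, r) j)
        = ∏ j : {j // j ≠ i}, q j (r j) := fun a => by
      rw [prod_subtype (univ.erase i) (p := fun j => j ≠ i) (by simp)
        (fun j => q j ((Equiv.funSplitAt i S).symm (a, r) j))]
      refine prod_congr rfl fun j _ => ?_
      simp [Equiv.funSplitAt, j.2]
    simp only [hu, hi, ← mul_prod_erase univ _ (mem_univ i), hj]
    have := hqf i fun a => V i ((Equiv.funSplitAt i S).symm (a, r))
    calc _ = (∏ j : {j // j ≠ i}, q j (r j)) * ∑ a, q i a * ∑ k : {k // o k = i}, c k *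
          (V i ((Equiv.funSplitAt i S).symm (φ k a, r)) - V i ((Equiv.funSplitAt i S).symm (a, r))) := by
          rw [mul_sum]; exact sum_congr rfl fun a _ => by ring
      _ = 0 := by rw [this, mul_zero]
  have h1 : (1 : ℝ) ≤ ∑ p : ι → S, (∏ i, q i (p i)) *
      ∑ k, c k * (V (o k) (Function.update p (o k) (φ k (p (o k)))) - V (o k) p) := by
    rw [← hw1]
    exact sum_le_sum fun p _ => le_mul_of_one_le_right (hw p) (hc1 p)
  have h0 : ∑ p : ι → S, (∏ i, q i (p i)) *
      ∑ k, c k * (V (o k) (Function.update p (o k) (φ k (p (o k)))) - V (o k) p) = 0 := by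
    rw [← sum_eq_zero fun i (_ : i ∈ univ) => hz i, sum_comm]
    refine sum_congr rfl fun p _ => ?_
    rw [← mul_sum, ← Fintype.sum_fiberwise o]
    congr 1
    refine sum_congr rfl fun i _ => sum_congr rfl fun k _ => ?_
    obtain ⟨k, rfl⟩ := k
    rfl
  linarith

theorem abs_prod_sub_prod_le {ι : Type*} (s : Finset ι) (f g : ι → ℝ)
    (hf : ∀ i, f i ∈ Set.Icc (0 : ℝ) 1) (hg : ∀ i, g i ∈ Set.Icc (0 : ℝ) 1) :
    |∏ i ∈ s, f i - ∏ i ∈ s, g i| ≤ ∑ i ∈ s, |f i - g i| := by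
  classical
  induction s using Finset.induction_on with
  | empty => simp
  | insert a s ha ih =>
    rw [prod_insert ha, prod_insert ha, sum_insert ha]
    have e : f a * ∏ i ∈ s, f i - g a * ∏ i ∈ s, g i
        = (f a - g a) * ∏ i ∈ s, f i + g a * (∏ i ∈ s, f i - ∏ i ∈ s, g i) := by ring
    have h1 : |∏ i ∈ s, f i| ≤ 1 := by
      rw [abs_of_nonneg (prod_nonneg fun i _ => (hf i).1)]
      exact prod_le_one (fun i _ => (hf i).1) fun i _ => (hf i).2
    have h2 : |g a| ≤ 1 := by rw [abs_of_nonneg (hg a).1]; exact (hg a).2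
    rw [e]
    refine (abs_add_le _ _).trans (add_le_add ?_ ?_)
    · rw [abs_mul]; exact mul_le_of_le_one_right (abs_nonneg _) h1
    · rw [abs_mul]; exact (mul_le_of_le_one_left (abs_nonneg _) h2).trans ih

/-! ### Game trees -/

namespace GameTree

variable {I : Type} {A : I → Type} {P : Type}

theorem chanceProb_mem_Icc (t : GameTree I A P) (z : t.Leaf) :
    t.chanceProb z ∈ Set.Icc (0 : ℝ) 1 := by
  induction t with
  | leaf u => exact ⟨zero_le_one, le_rfl⟩
  | chance p next ih =>
    have hp : p.1 z.1 ∈ Set.Icc (0 : ℝ) 1 := mem_Icc_of_mem_stdSimplex p.2 z.1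
    exact ⟨mul_nonneg hp.1 (ih z.1 z.2).1, mul_le_one₀ hp.2 (ih z.1 z.2).1 (ih z.1 z.2).2⟩
  | decision J next ih => exact ih z.1 z.2

theorem exists_index {k : ℕ} (p : stdSimplex ℝ (Fin k)) : Nonempty (Fin k) := by
  by_contra h
  rw [not_nonempty_iff] at h
  simpa using p.2.2

/-- The decisions on the path to a terminal node. -/
def path : (t : GameTree I A P) → t.Leaf → List ((J : I) × A J)
  | leaf _, _ => []
  | chance _ next, z => path (next z.1) z.2
  | decision J next, z => ⟨J, z.1⟩ :: path (next z.1) z.2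

open Classical in
theorem sequence_eq_filter (owner : I → P) (i : P) (t : GameTree I A P) (z : t.Leaf) :
    t.sequence owner i z = (t.path z).filter (fun p => owner p.1 = i) := by
  induction t with
  | leaf u => rfl
  | chance p next ih => exact ih z.1 z.2
  | decision J next ih =>
    simp only [sequence, path, List.filter_cons, decide_eq_true_eq, ih z.1 z.2]

/-- The set of the decision sequences along root-to-leaf paths. -/
def paths (t : GameTree I A P) : Set (List ((J : I) × A J)) := Set.range t.path

@[simp] theorem paths_leaf (u : P → ℝ) : (leaf u : GameTree I A P).paths = {[]} :=
  Set.ext fun _ => ⟨fun ⟨_, h⟩ => h.symm, fun h => ⟨(), h.symm⟩⟩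

theorem mem_paths_chance {k : ℕ} {p : stdSimplex ℝ (Fin k)} {next : Fin k → GameTree I A P}
    {l : List ((J : I) × A J)} : l ∈ (chance p next).paths ↔ ∃ c, l ∈ (next c).paths :=
  ⟨fun ⟨z, h⟩ => ⟨z.1, z.2, h⟩, fun ⟨c, z, h⟩ => ⟨⟨c, z⟩, h⟩⟩

theorem mem_paths_decision {J : I} {next : A J → GameTree I A P} {l : List ((J : I) × A J)} :
    l ∈ (decision J next).paths ↔ ∃ a, ∃ l' ∈ (next a).paths, l = ⟨J, a⟩ :: l' :=
  ⟨fun ⟨z, h⟩ => ⟨z.1, _, ⟨z.2, rfl⟩, h.symm⟩, fun ⟨a, _, ⟨z, h⟩, h'⟩ =>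
    ⟨⟨a, z⟩, by rw [h', ← h]; rfl⟩⟩

/-- The pure strategy profile `S` makes all decisions in `l`. -/
def Follows (S : ∀ J, A J) (l : List ((J : I) × A J)) : Prop := ∀ p ∈ l, S p.1 = p.2

@[simp] theorem follows_nil (S : ∀ J, A J) : Follows S [] := by simp [Follows]

@[simp] theorem follows_cons (S : ∀ J, A J) (p : (J : I) × A J) (l : List ((J : I) × A J)) :
    Follows S (p :: l) ↔ S p.1 = p.2 ∧ Follows S l := by simp [Follows]

theorem exists_path_follows (t : GameTree I A P) (S : ∀ J, A J) : ∃ l ∈ t.paths, Follows S l := by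
  induction t with
  | leaf u => simp
  | chance p next ih =>
    obtain ⟨c⟩ := exists_index p
    obtain ⟨l, hl, h⟩ := ih c
    exact ⟨l, mem_paths_chance.2 ⟨c, hl⟩, h⟩
  | decision J next ih =>
    obtain ⟨l, hl, h⟩ := ih (S J)
    exact ⟨_, mem_paths_decision.2 ⟨S J, l, hl, rfl⟩, by simp [h]⟩

/-- If `S` makes all decisions of the players in `q` on a path and `S'` does not, then `S'` makes all of
those decisions on a path where `S` does not. -/
theorem exists_path_follows_not_follows (q : I → Prop) [DecidablePred q] (t : GameTree I A P)
    (S S' : ∀ J, A J) {l : List ((J : I) × A J)} (hl : l ∈ t.paths)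
    (h : Follows S (l.filter fun p => q p.1)) (h' : ¬ Follows S' (l.filter fun p => q p.1)) :
    ∃ m ∈ t.paths, Follows S' (m.filter fun p => q p.1) ∧ ¬ Follows S (m.filter fun p => q p.1) := by
  induction t generalizing l with
  | leaf u =>
    rw [paths_leaf, Set.mem_singleton_iff] at hl
    subst hl
    simp at h'
  | chance p next ih =>
    obtain ⟨c, hc⟩ := mem_paths_chance.1 hl
    obtain ⟨m, hm, h⟩ := ih c hc h h'
    exact ⟨m, mem_paths_chance.2 ⟨c, hm⟩, h⟩
  | decision J next ih =>
    obtain ⟨a, l', hl', rfl⟩ := mem_paths_decision.1 hl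
    by_cases hJ : q J
    · simp only [List.filter_cons, hJ, decide_true, if_true, follows_cons] at h h'
      by_cases ha : S' J = a
      · obtain ⟨m, hm, h₁, h₂⟩ := ih a hl' h.2 (fun h'' => h' ⟨ha, h''⟩)
        exact ⟨_, mem_paths_decision.2 ⟨a, m, hm, rfl⟩, by simp [hJ, ha, h₁], by simp [hJ, h₂]⟩
      -- The profiles part at this node, so any continuation that follows `S'` will do.
      · obtain ⟨m, hm, h₁⟩ := exists_path_follows (next (S' J)) S'
        refine ⟨_, mem_paths_decision.2 ⟨S' J, m, hm, rfl⟩, ?_, ?_⟩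
        · simp only [List.filter_cons, hJ, decide_true, if_true, follows_cons, true_and]
          exact fun p hp => h₁ p (List.mem_of_mem_filter hp)
        · simp only [List.filter_cons, hJ, decide_true, if_true, follows_cons, h.1]
          exact fun h'' => ha h''.1.symm
    · simp only [List.filter_cons, hJ, decide_false] at h h'
      obtain ⟨m, hm, h₁, h₂⟩ := ih a hl' h h'
      exact ⟨_, mem_paths_decision.2 ⟨a, m, hm, rfl⟩, by simp [hJ, h₁], by simp [hJ, h₂]⟩

/-- The expected payoff under a pure strategy profile. -/
noncomputable def val (k : P) (S : ∀ J, A J) : GameTree I A P → ℝ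
  | leaf u => u k
  | chance p next => ∑ c, p.1 c * val k S (next c)
  | decision J next => val k S (next (S J))

open Classical in
theorem sum_follows_eq_val [∀ J, Fintype (A J)] (k : P) (S : ∀ J, A J) (t : GameTree I A P) :
    ∑ z : t.Leaf, (t.chanceProb z * if Follows S (t.path z) then 1 else 0) * t.payoff z k
      = val k S t := by
  induction t with
  | leaf u =>
    have : ∑ z : Unit, ((1 : ℝ) * if Follows S ([] : List ((J : I) × A J)) then 1 else 0) * u k
      = u k := by simp
    exact this
  | @chance k' p next ih =>
    refine (Fintype.sum_sigma (fun z : (c : Fin k') × (next c).Leaf =>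
      (p.1 z.1 * (next z.1).chanceProb z.2 * if Follows S ((next z.1).path z.2) then 1 else 0)
        * (next z.1).payoff z.2 k)).trans ?_
    refine sum_congr rfl fun c _ => ?_
    rw [← ih c, mul_sum]
    exact sum_congr rfl fun z _ => by ring
  | decision J next ih =>
    refine (Fintype.sum_sigma (fun z : (a : A J) × (next a).Leaf =>
      ((next z.1).chanceProb z.2 * if Follows S (⟨J, z.1⟩ :: (next z.1).path z.2) then 1 else 0)
        * (next z.1).payoff z.2 k)).trans ?_
    rw [sum_eq_single (S J)]
    · simp only [follows_cons, true_and]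
      exact ih _
    · intro a _ ha
      refine sum_eq_zero fun z _ => ?_
      simp [ha.symm]
    · simp

end GameTree

/-! ### Sequence-form strategies -/

namespace EFG

open GameTree

variable {P : Type} (G : EFG P)

instance : Nonempty G.Z := by
  obtain ⟨_, ⟨z, -⟩, -⟩ := exists_path_follows G.tree fun J => Classical.arbitrary (G.Act J)
  exact ⟨z⟩

/-- The pure strategy profile with the given strategies of the players. -/
def joint (s : (i : P) → G.Pure i) (J : G.Infoset) : G.Act J := s (G.owner J) ⟨J, rfl⟩

variable {G}

theorem joint_apply (s : (i : P) → G.Pure i) {i : P} {J : G.Infoset} (h : G.owner J = i) :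
    G.joint s J = s i ⟨J, h⟩ := by
  subst h; rfl

/-- Some extension of a pure strategy to the information sets of all players. -/
noncomputable def Pure.extend {i : P} (s : G.Pure i) (J : G.Infoset) : G.Act J :=
  open Classical in if h : G.owner J = i then s ⟨J, h⟩ else Classical.arbitrary _

theorem Pure.extend_apply {i : P} (s : G.Pure i) {J : G.Infoset} (h : G.owner J = i) :
    s.extend J = s ⟨J, h⟩ := dif_pos h

theorem mem_seq_iff {i : P} {z : G.Z} {p : (J : G.Infoset) × G.Act J} :
    p ∈ G.seq i z ↔ p ∈ G.tree.path z ∧ G.owner p.1 = i := by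
  classical
  rw [seq, sequence_eq_filter, List.mem_filter, decide_eq_true_iff]

open Classical in
theorem seqForm_apply {i : P} (s : G.Pure i) (S : ∀ J, G.Act J)
    (hS : ∀ J (h : G.owner J = i), S J = s ⟨J, h⟩) (σ : G.Seqs i) :
    G.seqForm s σ = if Follows S σ.1 then 1 else 0 := by
  obtain ⟨_, z, rfl⟩ := σ
  unfold seqForm
  congr 1
  refine propext ⟨fun h p hp => ?_, fun h J a hJ hp => ?_⟩
  · have hJ := (mem_seq_iff.1 hp).2
    rw [hS _ hJ]
    exact h p.1 p.2 hJ hp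
  · rw [← hS]
    exact h _ hp

theorem seqForm_eq_zero_or_one {i : P} (s : G.Pure i) (σ : G.Seqs i) :
    G.seqForm s σ = 0 ∨ G.seqForm s σ = 1 := by
  unfold seqForm
  split_ifs <;> simp

theorem seqForm_mem_X {i : P} (s : G.Pure i) : G.seqForm s ∈ G.X i :=
  subset_convexHull ℝ _ ⟨s, rfl⟩

theorem convex_X (i : P) : Convex ℝ (G.X i) := convex_convexHull ℝ _

theorem finite_range_seqForm (i : P) : (Set.range (G.seqForm (i := i))).Finite := by
  refine (Set.Finite.pi (t := fun _ => ({0, 1} : Set ℝ)) fun _ => Set.toFinite _).subset ?_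
  rintro _ ⟨s, rfl⟩ σ -
  exact seqForm_eq_zero_or_one s σ

theorem isCompact_X (i : P) : IsCompact (G.X i) := (finite_range_seqForm i).isCompact_convexHull ℝ

theorem mem_Icc_of_mem_X {i : P} {y : G.Vec i} (hy : y ∈ G.X i) (σ : G.Seqs i) :
    y σ ∈ Set.Icc (0 : ℝ) 1 := by
  have : G.X i ⊆ Set.Icc 0 1 := by
    refine convexHull_min ?_ (convex_Icc 0 1)
    rintro _ ⟨s, rfl⟩
    refine ⟨fun σ => ?_, fun σ => ?_⟩ <;>
    rcases seqForm_eq_zero_or_one s σ with h | h <;> simp [h]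
  exact ⟨(this hy).1 σ, (this hy).2 σ⟩

theorem at'_mem_Icc {i : P} {y : G.Vec i} (hy : y ∈ G.X i) (z : G.Z) :
    G.at' y z ∈ Set.Icc (0 : ℝ) 1 := mem_Icc_of_mem_X hy _

theorem le_of_mem_X {i : P} {f : G.Vec i → ℝ} (hf : IsLinearMap ℝ f) {c : ℝ}
    (h : ∀ s, f (G.seqForm s) ≤ c) {y : G.Vec i} (hy : y ∈ G.X i) : f y ≤ c := by
  refine convexHull_min ?_ (convex_halfSpace_le hf c) hy
  rintro _ ⟨s, rfl⟩
  exact h s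

theorem isLinearMap_at' {i : P} (z : G.Z) : IsLinearMap ℝ fun y : G.Vec i => G.at' y z :=
  ⟨fun _ _ => rfl, fun _ _ => rfl⟩

theorem isLinearMap_dotProduct {i : P} (d : G.Vec i) : IsLinearMap ℝ fun y : G.Vec i => d ⬝ᵥ y :=
  ⟨fun _ _ => dotProduct_add _ _ _, fun _ _ => dotProduct_smul _ _ _⟩

theorem seqForm_dotProduct_sub_nonneg {i : P} (s : G.Pure i) {y : G.Vec i} (hy : y ∈ G.X i) :
    0 ≤ G.seqForm s ⬝ᵥ (G.seqForm s - y) := by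
  refine sum_nonneg fun σ _ => ?_
  have := (mem_Icc_of_mem_X hy σ).2
  rcases seqForm_eq_zero_or_one s σ with h | h <;> simp [h, this]

/-- The weight of a pure strategy on the sequences of another one that it does not play. -/
theorem seqForm_dotProduct_sub_seqForm {i : P} (s s' : G.Pure i) :
    G.seqForm s ⬝ᵥ (G.seqForm s - G.seqForm s')
      = Nat.card {σ : G.Seqs i // G.seqForm s σ = 1 ∧ G.seqForm s' σ = 0} := by
  classical
  rw [Nat.card_eq_fintype_card, Fintype.card_subtype, card_eq_sum_ones, sum_filter, dotProduct]
  push_cast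
  refine sum_congr rfl fun σ _ => ?_
  rcases seqForm_eq_zero_or_one s σ with h | h <;>
  rcases seqForm_eq_zero_or_one s' σ with h' | h' <;> simp [h, h']

/-- For pure `y` the right side counts the sequences played by `s` and not by `y`, so it suffices to
exhibit one whenever the two differ at `z`. Both halves of the absolute value are linear in `y`,
which gives the mixed case. -/
theorem abs_seqForm_sub_le {i : P} (s : G.Pure i) {y : G.Vec i} (hy : y ∈ G.X i) (z : G.Z) :
    |G.at' (G.seqForm s) z - G.at' y z| ≤ G.seqForm s ⬝ᵥ (G.seqForm s - y) := by
  classical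
  have key : ∀ s' : G.Pure i, |G.at' (G.seqForm s) z - G.at' (G.seqForm s') z|
      ≤ G.seqForm s ⬝ᵥ (G.seqForm s - G.seqForm s') := by
    intro s'
    have one : ∀ σ, G.seqForm s σ = 1 → G.seqForm s' σ = 0 →
        1 ≤ G.seqForm s ⬝ᵥ (G.seqForm s - G.seqForm s') := fun σ h h' => by
      rw [seqForm_dotProduct_sub_seqForm, Nat.one_le_cast, Nat.one_le_iff_ne_zero]
      have : Nonempty {σ : G.Seqs i // G.seqForm s σ = 1 ∧ G.seqForm s' σ = 0} := ⟨⟨σ, h, h'⟩⟩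
      exact Nat.card_pos.ne'
    have nonneg := seqForm_dotProduct_sub_nonneg s (seqForm_mem_X s')
    unfold at'
    rcases seqForm_eq_zero_or_one s ⟨G.seq i z, z, rfl⟩ with h | h <;>
    rcases seqForm_eq_zero_or_one s' ⟨G.seq i z, z, rfl⟩ with h' | h'
    · simpa [h, h'] using nonneg
    -- Here `s'` reaches `z` and `s` does not, so the sequence of `z` is not among those counted.
    -- Following `s` from the point of disagreement leads to another leaf, whose sequence is.
    · rw [seqForm_apply s s.extend fun J h => s.extend_apply h] at h
      rw [seqForm_apply s' s'.extend fun J h => s'.extend_apply h] at h'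
      simp only [seq, sequence_eq_filter, ite_eq_left_iff, zero_ne_one, imp_false, not_not,
        ite_eq_right_iff, one_ne_zero] at h h'
      obtain ⟨_, ⟨w, rfl⟩, h₁, h₂⟩ := exists_path_follows_not_follows (fun J => G.owner J = i)
        G.tree s'.extend s.extend ⟨z, rfl⟩ h' h
      rw [← sequence_eq_filter] at h₁ h₂
      have := one ⟨G.seq i w, w, rfl⟩
        (by rw [seqForm_apply s s.extend fun J h => s.extend_apply h]; exact if_pos h₁)
        (by rw [seqForm_apply s' s'.extend fun J h => s'.extend_apply h]; exact if_neg h₂)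
      rw [seqForm_apply s s.extend fun J h => s.extend_apply h,
        seqForm_apply s' s'.extend fun J h => s'.extend_apply h]
      simp only [seq, sequence_eq_filter, if_neg h, if_pos h']
      simpa using this
    · simpa [h, h'] using one _ h h'
    · simpa [h, h'] using nonneg
  have l₁ : IsLinearMap ℝ fun y : G.Vec i => G.seqForm s ⬝ᵥ y - G.at' y z :=
    (isLinearMap_dotProduct _).mk' _ - (isLinearMap_at' z).mk' _ |>.isLinear
  have l₂ : IsLinearMap ℝ fun y : G.Vec i => G.seqForm s ⬝ᵥ y + G.at' y z :=
    (isLinearMap_dotProduct _).mk' _ + (isLinearMap_at' z).mk' _ |>.isLinear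
  have h₁ := le_of_mem_X l₁ (c := G.seqForm s ⬝ᵥ G.seqForm s - G.at' (G.seqForm s) z)
    (fun s' => by have := (abs_le.1 (key s')).2; rw [dotProduct_sub] at this; linarith) hy
  have h₂ := le_of_mem_X l₂ (c := G.seqForm s ⬝ᵥ G.seqForm s + G.at' (G.seqForm s) z)
    (fun s' => by have := (abs_le.1 (key s')).1; rw [dotProduct_sub] at this; linarith) hy
  rw [dotProduct_sub, abs_le]
  constructor <;> linarith

open Classical in
theorem prod_seqForm [Fintype P] (s : (i : P) → G.Pure i) (z : G.Z) :
    ∏ i, G.at' (G.seqForm (s i)) z = if Follows (G.joint s) (G.tree.path z) then 1 else 0 := by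
  unfold at'
  simp only [seqForm_apply (s _) (G.joint s) fun J h => joint_apply s h]
  rw [prod_boole]
  congr 1
  refine propext ⟨fun h p hp => h (G.owner p.1) (mem_univ _) p (mem_seq_iff.2 ⟨hp, rfl⟩),
    fun h i _ p hp => h p (mem_seq_iff.1 hp).1⟩

theorem u_seqForm [Fintype P] (k : P) (s : (i : P) → G.Pure i) :
    G.u k (fun i => G.seqForm (s i)) = G.tree.val k (G.joint s) := by
  rw [← sum_follows_eq_val]
  exact sum_congr rfl fun z _ => by rw [prod_seqForm]; rfl

end EFG

namespace EFG

variable {n : ℕ} {Γ : EFG (Option (Fin n))}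

/-! ### Utilities as multilinear functions -/

theorem um_eq (k : Option (Fin n)) (μ : Γ.Vec none) (x : Γ.Profile) :
    Γ.um k μ x = ∑ z, Γ.at' μ z * (Γ.tree.chanceProb z * Γ.payoff k z * Γ.hat x z) := by
  refine sum_congr rfl fun z _ => ?_
  rw [Fintype.prod_option]
  simp only [hat]
  ring

theorem hat_update (x : Γ.Profile) (i : Fin n) (y : Γ.Vec (some i)) (z : Γ.Z) :
    Γ.hat (Function.update x i y) z = Γ.at' y z * ∏ j ∈ univ.erase i, Γ.at' (x j) z := by
  rw [hat, ← mul_prod_erase univ _ (mem_univ i), Function.update_self]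
  congr 1
  refine prod_congr rfl fun j hj => ?_
  rw [Function.update_of_ne (ne_of_mem_erase hj)]

theorem um_update (k : Option (Fin n)) (μ : Γ.Vec none) (x : Γ.Profile) (i : Fin n)
    (y : Γ.Vec (some i)) :
    Γ.um k μ (Function.update x i y) = ∑ z, Γ.at' y z *
      (Γ.at' μ z * (Γ.tree.chanceProb z * Γ.payoff k z) * ∏ j ∈ univ.erase i, Γ.at' (x j) z) := by
  rw [um_eq]
  refine sum_congr rfl fun z _ => ?_
  rw [hat_update]
  ring

theorem isLinearMap_um (k : Option (Fin n)) (x : Γ.Profile) :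
    IsLinearMap ℝ fun μ : Γ.Vec none => Γ.um k μ x := by
  refine ⟨fun μ ν => ?_, fun c μ => ?_⟩
  · simp only [um_eq, ← sum_add_distrib, ← add_mul]; rfl
  · simp only [um_eq, smul_eq_mul, mul_sum, ← mul_assoc]; rfl

theorem isLinearMap_um_update (k : Option (Fin n)) (μ : Γ.Vec none) (x : Γ.Profile) (i : Fin n) :
    IsLinearMap ℝ fun y : Γ.Vec (some i) => Γ.um k μ (Function.update x i y) := by
  refine ⟨fun y y' => ?_, fun c y => ?_⟩
  · simp only [um_update, ← sum_add_distrib, ← add_mul]; rfl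
  · simp only [um_update, smul_eq_mul, mul_sum, ← mul_assoc]; rfl

theorem um_sum {ι : Type*} (S : Finset ι) (w : ι → ℝ) (μ : ι → Γ.Vec none) (k : Option (Fin n))
    (x : Γ.Profile) : Γ.um k (∑ t ∈ S, w t • μ t) x = ∑ t ∈ S, w t * Γ.um k (μ t) x := by
  have := map_sum ((isLinearMap_um k x).mk' _) (fun t => w t • μ t) S
  simp only [IsLinearMap.mk'_apply, (isLinearMap_um k x).map_smul, smul_eq_mul] at this
  exact this

theorem continuous_um (k : Option (Fin n)) (x : Γ.Profile) :
    Continuous fun μ : Γ.Vec none => Γ.um k μ x :=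
  ((isLinearMap_um k x).mk' _).continuous_of_finiteDimensional

theorem devGain_sum {ι : Type*} (S : Finset ι) (w : ι → ℝ) (μ : ι → Γ.Vec none) (d x : Γ.Profile) :
    Γ.devGain d (∑ t ∈ S, w t • μ t) x = ∑ t ∈ S, w t * Γ.devGain d (μ t) x := by
  simp only [devGain, um_sum, ← sum_sub_distrib, mul_sum, mul_sub]
  rw [sum_comm]

/-! ### Best responses and Lagrange multipliers -/

section Lagrange

variable {d : Γ.Profile}

/-- `s'` consists of best responses to `d` in the game `Γ^μ`. -/
def IsBestResponse (Γ : EFG (Option (Fin n))) (d : Γ.Profile) (μ : Γ.Vec none)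
    (s' : (i : Fin n) → Γ.Pure (some i)) : Prop :=
  ∀ i, ∀ y ∈ Γ.X (some i), Γ.um (some i) μ (Function.update d i y)
    ≤ Γ.um (some i) μ (Function.update d i (Γ.seqForm (s' i)))

theorem exists_isBestResponse (d : Γ.Profile) (μ : Γ.Vec none) :
    ∃ s', Γ.IsBestResponse d μ s' := by
  have : ∀ i, ∃ s' : Γ.Pure (some i), ∀ y ∈ Γ.X (some i), Γ.um (some i) μ (Function.update d i y)
    ≤ Γ.um (some i) μ (Function.update d i (Γ.seqForm s')) := fun i => by
    obtain ⟨_, ⟨s', rfl⟩, h⟩ := Set.exists_max_image _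
      (fun y => Γ.um (some i) μ (Function.update d i y)) (finite_range_seqForm (G := Γ) (some i))
      ⟨_, (fun J => Classical.arbitrary _), rfl⟩
    exact ⟨s', fun y hy => le_of_mem_X (isLinearMap_um_update _ _ _ _)
      (fun s'' => h _ ⟨s'', rfl⟩) hy⟩
  choose s' hs' using this
  exact ⟨s', hs'⟩

theorem seqForm_mem_XX (s' : (i : Fin n) → Γ.Pure (some i)) : (fun i => Γ.seqForm (s' i)) ∈ Γ.XX :=
  fun i => seqForm_mem_X (s' i)

theorem devGain_le_of_isBestResponse {μ : Γ.Vec none} {s' : (i : Fin n) → Γ.Pure (some i)}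
    (h : Γ.IsBestResponse d μ s') {x : Γ.Profile} (hx : x ∈ Γ.XX) :
    Γ.devGain d μ x ≤ Γ.devGain d μ fun i => Γ.seqForm (s' i) :=
  sum_le_sum fun i _ => sub_le_sub_right (h i _ (hx i)) _

theorem gain_le_devGain_of_isBestResponse (hd : d ∈ Γ.XX) {μ : Γ.Vec none}
    {s' : (i : Fin n) → Γ.Pure (some i)} (h : Γ.IsBestResponse d μ s') {i : Fin n}
    {y : Γ.Vec (some i)} (hy : y ∈ Γ.X (some i)) :
    Γ.um (some i) μ (Function.update d i y) - Γ.um (some i) μ d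
      ≤ Γ.devGain d μ fun i => Γ.seqForm (s' i) := by
  refine (sub_le_sub_right (h i y hy) _).trans (single_le_sum (f := fun i =>
    Γ.um (some i) μ (Function.update d i (Γ.seqForm (s' i))) - Γ.um (some i) μ d)
    (fun j _ => ?_) (mem_univ i))
  have := h j (d j) (hd j)
  rw [Function.update_eq_self] at this
  exact sub_nonneg.2 this

theorem devGain_self (d : Γ.Profile) (μ : Γ.Vec none) : Γ.devGain d μ d = 0 := by
  simp [devGain]

theorem IsEquilibrium.devGain_nonpos {μ : Γ.Vec none} (h : Γ.IsEquilibrium d μ) {x : Γ.Profile}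
    (hx : x ∈ Γ.XX) : Γ.devGain d μ x ≤ 0 :=
  sum_nonpos fun i _ => sub_nonpos.2 (h.2 i _ (hx i))

/-- `devGain` separates over the players, so the inner minimum is attained at a profile of pure best
responses. This also bounds the family below, without which the real infimum would be a junk value.
-/
theorem iInf_lagrangian {μ : Γ.Vec none} {s' : (i : Fin n) → Γ.Pure (some i)}
    (h : Γ.IsBestResponse d μ s') {lam : ℝ} (hlam : 0 ≤ lam) :
    ⨅ x : Γ.XX, (Γ.um none μ d - lam * Γ.devGain d μ x)
      = Γ.um none μ d - lam * Γ.devGain d μ fun i => Γ.seqForm (s' i) := by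
  have hl : ∀ x : Γ.XX, Γ.um none μ d - lam * Γ.devGain d μ (fun i => Γ.seqForm (s' i))
      ≤ Γ.um none μ d - lam * Γ.devGain d μ x := fun x =>
    sub_le_sub_left (mul_le_mul_of_nonneg_left (devGain_le_of_isBestResponse h x.2) hlam) _
  have : Nonempty Γ.XX := ⟨⟨_, seqForm_mem_XX s'⟩⟩
  refine le_antisymm (ciInf_le (f := fun x : Γ.XX => Γ.um none μ d - lam * Γ.devGain d μ x)
    ⟨Γ.um none μ d - lam * Γ.devGain d μ fun i => Γ.seqForm (s' i), ?_⟩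
    (⟨_, seqForm_mem_XX s'⟩ : Γ.XX)) (le_ciInf hl)
  rintro _ ⟨x, rfl⟩
  exact hl x

theorem exists_isOptimal (h : ∃ μ, Γ.IsEquilibrium d μ) : ∃ μ, Γ.IsOptimal d μ := by
  have hc : IsCompact {μ | Γ.IsEquilibrium d μ} := by
    refine (isCompact_X none).of_isClosed_subset ?_ fun μ hμ => hμ.1
    have : {μ | Γ.IsEquilibrium d μ} = Γ.X none ∩ ⋂ i, ⋂ y ∈ Γ.X (some i),
        {μ | Γ.um (some i) μ (Function.update d i y) ≤ Γ.um (some i) μ d} := by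
      ext μ
      simp [IsEquilibrium]
    rw [this]
    exact (isCompact_X none).isClosed.inter (isClosed_iInter fun i => isClosed_biInter fun y _ =>
      isClosed_le (continuous_um _ _) (continuous_um _ _))
  obtain ⟨μ, hμ, hmax⟩ := hc.exists_isMaxOn h (continuous_um none d).continuousOn
  exact ⟨μ, hμ, fun μ' hμ' => hmax hμ'⟩

/-- An optimal equilibrium solves the max-min problem at `lamStar` itself, and its value there is at
most its objective because `x = d` is admissible. Thus a mediator strategy can beat the optimum only
in proportion to the incentive to deviate. -/
theorem IsLagrangeThreshold.um_le {lamStar : ℝ} (h : Γ.IsLagrangeThreshold d lamStar)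
    (h0 : 0 ≤ lamStar) (hd : d ∈ Γ.XX) {μStar : Γ.Vec none} (hopt : Γ.IsOptimal d μStar)
    {μ : Γ.Vec none} (hμ : μ ∈ Γ.X none) {s' : (i : Fin n) → Γ.Pure (some i)}
    (hs' : Γ.IsBestResponse d μ s') :
    Γ.um none μ d - lamStar * Γ.devGain d μ (fun i => Γ.seqForm (s' i)) ≤ Γ.um none μStar d := by
  obtain ⟨t, ht⟩ := exists_isBestResponse d μStar
  have h₁ := ((h lamStar le_rfl μStar).2 hopt).2 hμ
  simp only [Set.mem_ofPred_eq] at h₁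
  rw [iInf_lagrangian hs' h0, iInf_lagrangian ht h0] at h₁
  have h₂ := devGain_le_of_isBestResponse ht hd
  rw [devGain_self] at h₂
  exact h₁.trans (sub_le_self _ (mul_nonneg h0 h₂))

/-- Finitely many Lagrange multipliers certify the optimal value. -/
theorem exists_penalty (hd : d ∈ Γ.XX) {μStar : Γ.Vec none} (hopt : Γ.IsOptimal d μStar) :
    ∃ C : ℝ, 0 ≤ C ∧ ∀ μ ∈ Γ.X none, ∀ s', Γ.IsBestResponse d μ s' →
      Γ.um none μ d - Γ.um none μStar d ≤ C * Γ.devGain d μ fun i => Γ.seqForm (s' i) := by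
  have : Fintype (Set.range (Γ.seqForm (i := none))) := (finite_range_seqForm none).fintype
  have : ∀ i : Fin n, Fintype (Set.range (Γ.seqForm (i := some i))) :=
    fun i => (finite_range_seqForm (some i)).fintype
  let H : ((i : Fin n) × Set.range (Γ.seqForm (i := some i))) → Γ.Vec none → ℝ := fun k μ =>
    Γ.um (some k.1) μ (Function.update d k.1 k.2.1) - Γ.um (some k.1) μ d
  have hH : ∀ k, IsLinearMap ℝ (H k) := fun k =>
    ((isLinearMap_um _ _).mk' _ - (isLinearMap_um _ _).mk' _ : Γ.Vec none →ₗ[ℝ] ℝ).isLinear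
  have hHX : ∀ k : (i : Fin n) × Set.range (Γ.seqForm (i := some i)), k.2.1 ∈ Γ.X (some k.1) :=
    fun k => subset_convexHull ℝ _ k.2.2
  obtain ⟨c, hc, hb⟩ := farkas_weights (V := Set.range (Γ.seqForm (i := none)))
    (fun k v => H k v) (fun v => Γ.um none v d - Γ.um none μStar d) fun w hw hk => by
      rcases (sum_nonneg fun v _ => hw v).eq_or_lt with h0 | hpos
      · have := (sum_eq_zero_iff_of_nonneg fun v _ => hw v).1 h0.symm
        refine (sum_eq_zero fun v hv => ?_).le
        rw [this v hv, zero_mul]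
      · set W := ∑ v, w v
        have hsum : ∀ k x, Γ.um k (∑ v, (W⁻¹ * w v) • v.1) x = W⁻¹ * ∑ v, w v * Γ.um k v x := by
          intro k x
          rw [um_sum, mul_sum]
          exact sum_congr rfl fun v _ => by ring
        -- The hypothesis of Farkas' lemma: weights on the vertices of `X₀` satisfying the incentive
        -- constraints at the vertices of each `Xᵢ` normalize to an equilibrium, whose objective
        -- cannot exceed the optimum.
        have heq : Γ.IsEquilibrium d (∑ v, (W⁻¹ * w v) • v.1) := by
          refine ⟨(convex_X none).sum_mem (fun v _ => mul_nonneg (inv_nonneg.2 hpos.le) (hw v)) ?_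
            fun v _ => subset_convexHull ℝ _ v.2, fun i y hy => ?_⟩
          · rw [← mul_sum, inv_mul_cancel₀ hpos.ne']
          · refine le_of_mem_X (isLinearMap_um_update _ _ _ _) (fun s' => ?_) hy
            have := hk ⟨i, _, s', rfl⟩
            simp only [H, mul_sub, sum_sub_distrib] at this
            rw [hsum, hsum]
            exact mul_le_mul_of_nonneg_left (sub_nonpos.1 this) (inv_nonneg.2 hpos.le)
        have := hopt.2 _ heq
        rw [hsum, inv_mul_le_iff₀ hpos] at this
        simp only [mul_sub, sum_sub_distrib, ← sum_mul]
        exact sub_nonpos.2 this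
  refine ⟨∑ k, c k, sum_nonneg fun k _ => hc k, fun μ hμ s' hs' => ?_⟩
  have hl : Γ.um none μ d - ∑ k, c k * H k μ ≤ Γ.um none μStar d := by
    have hlin : IsLinearMap ℝ fun μ => Γ.um none μ d - ∑ k, c k * H k μ := by
      refine ⟨fun x y => ?_, fun a x => ?_⟩
      · simp only [(isLinearMap_um none d).map_add, (hH _).map_add, mul_add, sum_add_distrib]
        ring
      · simp only [(isLinearMap_um none d).map_smul, (hH _).map_smul, smul_eq_mul, mul_sub,
          mul_left_comm, ← mul_sum]
    refine le_of_mem_X hlin (fun v => ?_) hμ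
    have := hb ⟨_, v, rfl⟩
    linarith
  have : ∑ k, c k * H k μ ≤ (∑ k, c k) * Γ.devGain d μ fun i => Γ.seqForm (s' i) := by
    rw [sum_mul]
    exact sum_le_sum fun k _ =>
      mul_le_mul_of_nonneg_left (gain_le_devGain_of_isBestResponse hd hs' (hHX k)) (hc k)
  linarith

/-- Exact penalization: the multiplier `C` of `exists_penalty` already prevents any profit from
violating incentives. One unit more makes a violation strictly costly, so every maximizer has zero
deviation gain and is an equilibrium. -/
theorem exists_isLagrangeThreshold (hd : d ∈ Γ.XX) (h : ∃ μ, Γ.IsEquilibrium d μ) :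
    ∃ lamStar : ℝ, 1 ≤ lamStar ∧ Γ.IsLagrangeThreshold d lamStar := by
  obtain ⟨μStar, hopt⟩ := exists_isOptimal h
  obtain ⟨C, hC, hpen⟩ := exists_penalty hd hopt
  refine ⟨C + 1, by linarith, fun lam hlam μ => ?_⟩
  have h0 : 0 ≤ lam := by linarith
  have hnonneg : ∀ {μ s'}, Γ.IsBestResponse d μ s' →
      0 ≤ Γ.devGain d μ fun i => Γ.seqForm (s' i) := fun hs' => by
    have := devGain_le_of_isBestResponse hs' hd
    rwa [devGain_self] at this
  have heq : ∀ {μ s'}, Γ.IsEquilibrium d μ → Γ.IsBestResponse d μ s' →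
      (Γ.devGain d μ fun i => Γ.seqForm (s' i)) = 0 := fun hμ hs' =>
    le_antisymm (hμ.devGain_nonpos (seqForm_mem_XX _)) (hnonneg hs')
  have hup : ∀ μ ∈ Γ.X none, ∀ s', Γ.IsBestResponse d μ s' →
      Γ.um none μ d - lam * (Γ.devGain d μ fun i => Γ.seqForm (s' i))
        ≤ Γ.um none μStar d - Γ.devGain d μ fun i => Γ.seqForm (s' i) := fun μ hμ s' hs' => by
    have h₁ := hpen μ hμ s' hs'
    have h₂ := mul_le_mul_of_nonneg_right hlam (hnonneg hs')
    linarith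
  constructor
  · rintro ⟨hμ, hmax⟩
    obtain ⟨s', hs'⟩ := exists_isBestResponse d μ
    obtain ⟨t, ht⟩ := exists_isBestResponse d μStar
    have h₁ := hmax hopt.1.1
    simp only [Set.mem_ofPred_eq] at h₁
    rw [iInf_lagrangian hs' h0, iInf_lagrangian ht h0, heq hopt.1 ht, mul_zero, sub_zero] at h₁
    have h₂ := hup μ hμ s' hs'
    have h₃ := hnonneg hs'
    have h₄ : (Γ.devGain d μ fun i => Γ.seqForm (s' i)) = 0 := by linarith
    refine ⟨⟨hμ, fun i y hy => ?_⟩, fun μ' hμ' => (hopt.2 μ' hμ').trans ?_⟩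
    · have := gain_le_devGain_of_isBestResponse hd hs' hy
      linarith
    · rw [h₄] at h₁
      linarith
  · intro hμ
    refine ⟨hμ.1.1, fun ν hν => ?_⟩
    obtain ⟨s', hs'⟩ := exists_isBestResponse d μ
    obtain ⟨t, ht⟩ := exists_isBestResponse d ν
    simp only [Set.mem_ofPred_eq]
    rw [iInf_lagrangian hs' h0, iInf_lagrangian ht h0, heq hμ.1 hs', mul_zero, sub_zero]
    have h₁ := hup ν hν t ht
    have h₂ := hnonneg ht
    have h₃ := hμ.2 _ hopt.1
    linarith

end Lagrange

/-! ### Steering -/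

section Steering

variable {s : (i : Fin n) → Γ.Pure (some i)} {d : Γ.Profile}

/-- `∑ᵢ dᵢ ⬝ (dᵢ - xᵢ)`, a measure of how far `x` is from the pure profile `d`. -/
noncomputable def deficit (d x : Γ.Profile) : ℝ := ∑ i, d i ⬝ᵥ (d i - x i)

theorem deficit_nonneg (hd : ∀ i, d i = Γ.seqForm (s i)) {x : Γ.Profile} (hx : x ∈ Γ.XX) :
    0 ≤ deficit d x := sum_nonneg fun i _ => by
  rw [hd]; exact seqForm_dotProduct_sub_nonneg _ (hx i)

theorem abs_prod_at'_sub_le (hd : ∀ i, d i = Γ.seqForm (s i)) {x : Γ.Profile} (hx : x ∈ Γ.XX)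
    (S : Finset (Fin n)) (z : Γ.Z) :
    |∏ i ∈ S, Γ.at' (d i) z - ∏ i ∈ S, Γ.at' (x i) z| ≤ deficit d x := by
  have hd' : ∀ i, d i ∈ Γ.X (some i) := fun i => hd i ▸ seqForm_mem_X _
  refine (abs_prod_sub_prod_le S _ _ (fun i => at'_mem_Icc (hd' i) z)
    fun i => at'_mem_Icc (hx i) z).trans ?_
  refine (sum_le_sum fun i _ => ?_).trans (sum_le_sum_of_subset_of_nonneg (subset_univ S)
    fun i _ _ => ?_)
  · rw [hd]; exact abs_seqForm_sub_le _ (hx i) z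
  · rw [hd]; exact seqForm_dotProduct_sub_nonneg _ (hx i)

theorem prod_at'_mem_Icc {x : Γ.Profile} (hx : x ∈ Γ.XX) (S : Finset (Fin n)) (z : Γ.Z) :
    ∏ i ∈ S, Γ.at' (x i) z ∈ Set.Icc (0 : ℝ) 1 :=
  ⟨prod_nonneg fun i _ => (at'_mem_Icc (hx i) z).1,
    prod_le_one (fun i _ => (at'_mem_Icc (hx i) z).1) fun i _ => (at'_mem_Icc (hx i) z).2⟩

theorem abs_prod_at'_sub_le_one {x y : Γ.Profile} (hx : x ∈ Γ.XX) (hy : y ∈ Γ.XX)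
    (S : Finset (Fin n)) (z : Γ.Z) :
    |∏ i ∈ S, Γ.at' (x i) z - ∏ i ∈ S, Γ.at' (y i) z| ≤ 1 := by
  have h₁ := prod_at'_mem_Icc hx S z
  have h₂ := prod_at'_mem_Icc hy S z
  rw [abs_le]
  constructor <;> linarith [h₁.1, h₁.2, h₂.1, h₂.2]

theorem coeff_mem_Icc (hΓ : ∀ k z, Γ.payoff k z ∈ Set.Icc (0 : ℝ) 1) (k : Option (Fin n))
    {μ : Γ.Vec none} (hμ : μ ∈ Γ.X none) (z : Γ.Z) :
    Γ.at' μ z * (Γ.tree.chanceProb z * Γ.payoff k z) ∈ Set.Icc (0 : ℝ) 1 := by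
  have h₁ := at'_mem_Icc hμ z
  have h₂ := Γ.tree.chanceProb_mem_Icc z
  have h₃ := hΓ k z
  have h₄ := mul_nonneg h₂.1 h₃.1
  exact ⟨mul_nonneg h₁.1 h₄, mul_le_one₀ h₁.2 h₄ (mul_le_one₀ h₂.2 h₃.1 h₃.2)⟩

theorem um_mem_Icc (hΓ : ∀ k z, Γ.payoff k z ∈ Set.Icc (0 : ℝ) 1) (k : Option (Fin n))
    {μ : Γ.Vec none} (hμ : μ ∈ Γ.X none) {x : Γ.Profile} (hx : x ∈ Γ.XX) :
    Γ.um k μ x ∈ Set.Icc (0 : ℝ) (Fintype.card Γ.Z) := by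
  have h : ∀ z, Γ.at' μ z * (Γ.tree.chanceProb z * Γ.payoff k z * Γ.hat x z) ∈ Set.Icc (0 : ℝ) 1 :=
    fun z => by
      have h₁ := coeff_mem_Icc hΓ k hμ z
      have h₂ : Γ.hat x z ∈ Set.Icc (0 : ℝ) 1 := prod_at'_mem_Icc hx univ z
      rw [← mul_assoc]
      exact ⟨mul_nonneg h₁.1 h₂.1, mul_le_one₀ h₁.2 h₂.1 h₂.2⟩
  rw [um_eq]
  refine ⟨sum_nonneg fun z _ => (h z).1, (sum_le_sum fun z _ => (h z).2).trans ?_⟩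
  simp

theorem um_sub_le (hΓ : ∀ k z, Γ.payoff k z ∈ Set.Icc (0 : ℝ) 1)
    (hd : ∀ i, d i = Γ.seqForm (s i)) (k : Option (Fin n))
    {μ : Γ.Vec none} (hμ : μ ∈ Γ.X none) {x : Γ.Profile} (hx : x ∈ Γ.XX) :
    Γ.um k μ d - Γ.um k μ x ≤ Fintype.card Γ.Z * deficit d x := by
  rw [um_eq, um_eq, ← sum_sub_distrib]
  refine (sum_le_card_nsmul univ _ (deficit d x) fun z _ => ?_).trans (by simp)
  have h₁ := coeff_mem_Icc hΓ k hμ z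
  calc _ = (Γ.at' μ z * (Γ.tree.chanceProb z * Γ.payoff k z)) * (Γ.hat d z - Γ.hat x z) := by ring
    _ ≤ (Γ.at' μ z * (Γ.tree.chanceProb z * Γ.payoff k z)) * deficit d x :=
      mul_le_mul_of_nonneg_left ((le_abs_self _).trans (abs_prod_at'_sub_le hd hx univ z)) h₁.1
    _ ≤ deficit d x := mul_le_of_le_one_left (deficit_nonneg hd hx) h₁.2

/-- The bracket minus its value at any `y` is a sum over leaves of terms containing the factor
(xᵢ[z] - y[z])(∏ d - ∏ x), with products over the opponents; the second factor is small when `x` is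
close to `d`. The alternative bound 1 in the minimum serves the regime where `deficit` is not
controlled. The `α` part uses that there are at most as many sequences as leaves. -/
theorem payment_le (hΓ : ∀ k z, Γ.payoff k z ∈ Set.Icc (0 : ℝ) 1)
    (hd : ∀ i, d i = Γ.seqForm (s i)) {μ : Γ.Vec none} (hμ : μ ∈ Γ.X none) {x : Γ.Profile}
    (hx : x ∈ Γ.XX) {α : ℝ} (hα : 0 ≤ α) (i : Fin n) :
    Γ.payment d α μ i x ≤ α * Fintype.card Γ.Z + Fintype.card Γ.Z * min 1 (deficit d x) := by
  have hdX : d ∈ Γ.XX := fun i => hd i ▸ seqForm_mem_X _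
  have hdot : d i ⬝ᵥ x i ≤ Fintype.card Γ.Z := by
    have h₁ : d i ⬝ᵥ x i ≤ Fintype.card (Γ.Seqs (some i)) := by
      refine (sum_le_card_nsmul univ _ 1 fun σ _ => ?_).trans (by simp)
      have h₂ := mem_Icc_of_mem_X (hdX i) σ
      have h₃ := mem_Icc_of_mem_X (hx i) σ
      exact mul_le_one₀ h₂.2 h₃.1 h₃.2
    refine h₁.trans (Nat.cast_le.2 ?_)
    exact Fintype.card_le_of_surjective (fun z => ⟨Γ.seq (some i) z, z, rfl⟩)
      fun ⟨_, z, h⟩ => ⟨z, Subtype.ext h⟩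
  have : Nonempty (Γ.X (some i)) := ⟨⟨d i, hdX i⟩⟩
  have hinf : Γ.um (some i) μ (Function.update d i (x i)) - Γ.um (some i) μ x
      - Fintype.card Γ.Z * min 1 (deficit d x) ≤ ⨅ y : Γ.X (some i),
        (Γ.um (some i) μ (Function.update d i y) - Γ.um (some i) μ (Function.update x i y)) := by
    refine le_ciInf fun y => ?_
    have e : Γ.um (some i) μ x = Γ.um (some i) μ (Function.update x i (x i)) := by
      rw [Function.update_eq_self]
    rw [sub_le_comm, e]
    simp only [um_update, ← sum_sub_distrib]
    refine (sum_le_card_nsmul univ _ (min 1 (deficit d x)) fun z _ => ?_).trans (by simp)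
    have h₁ := coeff_mem_Icc hΓ (some i) hμ z
    set a := Γ.at' μ z * (Γ.tree.chanceProb z * Γ.payoff (some i) z)
    have h₂ := at'_mem_Icc (hx i) z
    have h₃ := at'_mem_Icc y.2 z
    have h₄ : |Γ.at' (x i) z - Γ.at' (y : Γ.Vec (some i)) z| ≤ 1 := by
      rw [abs_le]; constructor <;> linarith [h₂.1, h₂.2, h₃.1, h₃.2]
    have h₅ := le_min (abs_prod_at'_sub_le_one hdX hx (univ.erase i) z)
      (abs_prod_at'_sub_le hd hx (univ.erase i) z)
    refine (le_abs_self _).trans ?_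
    calc _ = |a| * |Γ.at' (x i) z - Γ.at' (y : Γ.Vec (some i)) z| *
          |∏ j ∈ univ.erase i, Γ.at' (d j) z - ∏ j ∈ univ.erase i, Γ.at' (x j) z| := by
          rw [← abs_mul, ← abs_mul]; congr 1; ring
      _ ≤ 1 * _ := by
          refine mul_le_mul_of_nonneg_right (mul_le_one₀ ?_ (abs_nonneg _) h₄) (abs_nonneg _)
          rw [abs_of_nonneg h₁.1]; exact h₁.2
      _ ≤ _ := by rw [one_mul]; exact h₅
  have := mul_le_mul_of_nonneg_left hdot hα
  unfold payment
  linarith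

/-- The point of the payment rule: the utility under `x` cancels and the infimum does not involve
player `i`'s own strategy, so incentives are those against obedient opponents plus the `α` bonus. -/
theorem paidUtility_update_sub (α : ℝ) (μ : Γ.Vec none) (i : Fin n) (x : Γ.Profile)
    (y : Γ.Vec (some i)) :
    Γ.paidUtility d α μ i (Function.update x i y) - Γ.paidUtility d α μ i x
      = α * (d i ⬝ᵥ (d i - x i) - d i ⬝ᵥ (d i - y))
        + (Γ.um (some i) μ (Function.update d i y)
          - Γ.um (some i) μ (Function.update d i (x i))) := by
  simp only [paidUtility, payment, Function.update_self, Function.update_idem, dotProduct_sub]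
  ring

/-- The trade-off between incentives and the mediator's objective after low-regret play. -/
theorem regret_tradeoff {lam α r₀ r : ℝ} {T : ℕ} (hT : 0 < T) {μ : ℕ → Γ.Vec none}
    {x : ℕ → Γ.Profile} (hx : ∀ t < T, x t ∈ Γ.XX) (hmed : Γ.MediatorRegretLE d lam T μ x r₀)
    (hpl : ∀ i, Γ.PlayerRegretLE d α T μ x i r) {μStar : Γ.Vec none}
    (heq : Γ.IsEquilibrium d μStar) {y : Γ.Profile} (hy : y ∈ Γ.XX) :
    α * (1 / T * ∑ t ∈ range T, deficit d (x t) - deficit d y)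
      + Γ.devGain d (∑ t ∈ range T, (1 / T : ℝ) • μ t) y
      + 1 / lam * (Γ.um none μStar d - Γ.um none (∑ t ∈ range T, (1 / T : ℝ) • μ t) d)
      ≤ (r₀ + 4 * n * r) / T := by
  have hT' : (0 : ℝ) < T := Nat.cast_pos.2 hT
  have h₁ := hmed μStar heq.1
  have h₂ : ∑ t ∈ range T, (α * (deficit d (x t) - deficit d y) +
      (Γ.devGain d (μ t) y - Γ.devGain d (μ t) (x t))) ≤ 4 * n * r := by
    have : ∀ i : Fin n, ∑ t ∈ range T, (α * (d i ⬝ᵥ (d i - x t i) - d i ⬝ᵥ (d i - y i))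
        + (Γ.um (some i) (μ t) (Function.update d i (y i))
          - Γ.um (some i) (μ t) (Function.update d i (x t i)))) ≤ 4 * r := fun i => by
      have := hpl i (y i) (hy i)
      rw [← sum_sub_distrib] at this
      simp only [paidUtility_update_sub] at this
      linarith
    calc _ = ∑ i : Fin n, ∑ t ∈ range T, (α * (d i ⬝ᵥ (d i - x t i) - d i ⬝ᵥ (d i - y i))
        + (Γ.um (some i) (μ t) (Function.update d i (y i))
          - Γ.um (some i) (μ t) (Function.update d i (x t i)))) := by
          rw [sum_comm]
          refine sum_congr rfl fun t _ => ?_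
          simp only [deficit, devGain, ← sum_sub_distrib, mul_sum, ← sum_add_distrib]
          exact sum_congr rfl fun i _ => by ring
      _ ≤ ∑ i : Fin n, 4 * r := sum_le_sum fun i _ => this i
      _ = 4 * n * r := by simp; ring
  -- When `h₁` and `h₂` are added, the terms `devGain d (μ t) (x t)` cancel; what remains of the
  -- players' play is this sum.
  have h₃ : ∑ t ∈ range T, Γ.devGain d μStar (x t) ≤ 0 :=
    sum_nonpos fun t ht => heq.devGain_nonpos (hx t (mem_range.1 ht))
  simp only [mediatorUtility, sum_sub_distrib, sum_add_distrib, ← mul_sum, sum_const, card_range,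
    nsmul_eq_mul] at h₁ h₂
  rw [le_div_iff₀ hT', devGain_sum, um_sum, ← mul_sum, ← mul_sum]
  have e : ∀ a b c D u : ℝ, (α * (1 / T * a - D) + 1 / T * b + 1 / lam * (u - 1 / T * c)) * T
      = α * (a - T * D) + b + 1 / lam * (T * u - c) := fun a b c D u => by
    field_simp
  rw [e]
  linarith

/-- Here `A` is the average deficit, `Δ` the shortfall of the averaged mediator strategy from the
optimum, and `B`, `g` the deficit and deviation gain of a best response. `h₁` and `h₂` are the
trade-off for `d` and for the best response; `h₃` is the threshold property. -/
theorem steering_arithmetic {κ N L A B Δ g : ℝ} (hκ : 0 < κ) (hκ1 : κ ≤ 1) (hN : 1 ≤ N)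
    (hL : 1 ≤ L) (hlam : 2 * L ≤ N / κ) (hA : 0 ≤ A) (hB : B ≤ N)
    (h₁ : κ ^ 2 / N * A + 1 / (N / κ) * Δ ≤ κ ^ 3 / N)
    (h₂ : κ ^ 2 / N * (A - B) + g + 1 / (N / κ) * Δ ≤ κ ^ 3 / N) (h₃ : -Δ ≤ L * g) :
    A ≤ 5 * L * κ ∧ Δ ≤ κ ^ 2 := by
  have hN0 : 0 < N := by linarith
  have k₁ : κ * A + Δ ≤ κ ^ 2 := by
    have := mul_le_mul_of_nonneg_right h₁ (div_pos hN0 hκ).le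
    field_simp at this
    nlinarith
  have k₂ : κ ^ 2 * (A - B) + N * g + κ * Δ ≤ κ ^ 3 := by
    have := mul_le_mul_of_nonneg_right h₂ hN0.le
    field_simp at this
    linarith
  have hlam' : 2 * L * κ ≤ N := by rwa [le_div_iff₀ hκ] at hlam
  have hΔ : Δ ≤ κ ^ 2 := by nlinarith
  refine ⟨?_, hΔ⟩
  -- By `h₂` and `h₃`, N(-Δ) ≤ 2LNκ² + Lκ(-Δ), and 2Lκ ≤ N absorbs half of the left side. Then κA ≤
  -- κ² - Δ ≤ 5Lκ².
  have hneg : -Δ ≤ 4 * L * κ ^ 2 := by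
    by_contra hlt
    push Not at hlt
    have hpos : 0 < -Δ := lt_of_le_of_lt (by positivity) hlt
    have hNg : N * g ≤ κ ^ 3 + κ ^ 2 * N + κ * (-Δ) := by
      nlinarith [mul_nonneg (sq_nonneg κ) hA, mul_le_mul_of_nonneg_left hB (sq_nonneg κ)]
    have hκ3 : κ ^ 3 ≤ κ ^ 2 * N := by
      nlinarith [mul_nonneg (sq_nonneg κ) (by linarith : 0 ≤ N - κ)]
    have h5 : N * (-Δ) ≤ L * (2 * (κ ^ 2 * N) + κ * (-Δ)) := by
      calc N * (-Δ) ≤ N * (L * g) := mul_le_mul_of_nonneg_left h₃ hN0.le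
        _ = L * (N * g) := by ring
        _ ≤ _ := mul_le_mul_of_nonneg_left (by linarith) (by linarith)
    have h6 : 2 * L * κ * (-Δ) ≤ N * (-Δ) := mul_le_mul_of_nonneg_right hlam' hpos.le
    have h7 : N * (-Δ) ≤ N * (4 * L * κ ^ 2) := by nlinarith
    exact absurd (le_of_mul_le_mul_left h7 hN0) (not_le.2 hlt)
  have : κ * A ≤ κ * (5 * L * κ) := by nlinarith [sq_nonneg κ]
  exact le_of_mul_le_mul_left this hκ

theorem directnessGap_le {T : ℕ} (hT : 0 < T) {x : ℕ → Γ.Profile} {c : ℕ → ℝ}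
    (h : ∀ t < T, ∀ z, |Γ.hat d z - Γ.hat (x t) z| ≤ c t) :
    Γ.directnessGap d T x ≤ Fintype.card Γ.Z * (1 / T * ∑ t ∈ range T, c t) := by
  have hT' : (0 : ℝ) < T := Nat.cast_pos.2 hT
  refine (sum_le_card_nsmul univ _ (1 / T * ∑ t ∈ range T, c t) fun z _ => ?_).trans (by simp)
  have e : 1 / (T : ℝ) * ∑ t ∈ range T, Γ.hat (x t) z - Γ.hat d z
      = 1 / T * ∑ t ∈ range T, (Γ.hat (x t) z - Γ.hat d z) := by
    simp only [sum_sub_distrib, sum_const, card_range, nsmul_eq_mul]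
    field_simp
  rw [e, abs_mul, abs_of_pos (by positivity)]
  refine mul_le_mul_of_nonneg_left ((abs_sum_le_sum_abs _ _).trans
    (sum_le_sum fun t ht => ?_)) (by positivity)
  rw [abs_sub_comm]
  exact h t (mem_range.1 ht) z

theorem online_steer_bounds (hΓ : ∀ k z, Γ.payoff k z ∈ Set.Icc (0 : ℝ) 1)
    (hd : ∀ i, d i = Γ.seqForm (s i))
    (hbr : ∀ μ ∈ Γ.X none, ∃ s', Γ.IsBestResponse d μ s' ∧
      deficit d (fun i => Γ.seqForm (s' i)) ≤ Fintype.card Γ.Z)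
    {L : ℝ} (hL : 1 ≤ L) (hthr : Γ.IsLagrangeThreshold d L)
    {r₀ r κ N α lam : ℝ} {T : ℕ} (hN : N = Fintype.card Γ.Z) (hT : 0 < T) (hκ : 0 < κ)
    (hκ1 : κ ≤ 1) (hα : α = κ ^ 2 / N) (hlam : lam = N / κ)
    (hε : (r₀ + 4 * n * r) / T = κ ^ 3 / N) {μ : ℕ → Γ.Vec none} {x : ℕ → Γ.Profile}
    (hμ : ∀ t < T, μ t ∈ Γ.X none) (hx : ∀ t < T, x t ∈ Γ.XX)
    (hmed : Γ.MediatorRegretLE d lam T μ x r₀) (hpl : ∀ i, Γ.PlayerRegretLE d α T μ x i r)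
    {μStar : Γ.Vec none} (hopt : Γ.IsOptimal d μStar) :
    (∀ i, Γ.averagePayment d α T μ x i ≤ 7 * L * (N * κ)) ∧
      Γ.directnessGap d T x ≤ 7 * L * (N * κ) ∧
      Γ.optimalityGap d μStar T μ x ≤ 7 * L * (N * κ) := by
  have hN1 : 1 ≤ N := by
    rw [hN]
    exact_mod_cast Fintype.card_pos (α := Γ.Z)
  have hN0 : 0 < N := by linarith
  have hT' : (0 : ℝ) < T := Nat.cast_pos.2 hT
  have hdX : d ∈ Γ.XX := fun i => hd i ▸ seqForm_mem_X _
  have hα0 : 0 ≤ α := by rw [hα]; positivity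
  have hαN : α * N = κ ^ 2 := by rw [hα]; field_simp
  have hκ2 : κ ^ 2 ≤ κ := by nlinarith
  have havg : ∀ {f : ℕ → ℝ} {c : ℝ}, (∀ t < T, f t ≤ c) → 1 / (T : ℝ) * ∑ t ∈ range T, f t ≤ c :=
    fun {f c} h => by
      have := sum_le_card_nsmul (range T) f c fun t ht => h t (mem_range.1 ht)
      rw [card_range, nsmul_eq_mul] at this
      rw [one_div, inv_mul_le_iff₀ hT']
      exact this
  have hmono : ∀ {f g : ℕ → ℝ}, (∀ t < T, f t ≤ g t) →
      1 / (T : ℝ) * ∑ t ∈ range T, f t ≤ 1 / T * ∑ t ∈ range T, g t := fun h =>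
    mul_le_mul_of_nonneg_left (sum_le_sum fun t ht => h t (mem_range.1 ht)) (by positivity)
  -- In the first case each gap is at most N·A + κ² ≤ 6LNκ. In the second, N < 2Lκ, and the trivial
  -- bound 3N suffices: since N ≥ 1, 7Lκ exceeds 7/2.
  by_cases hcase : 2 * L ≤ N / κ
  · set A := 1 / (T : ℝ) * ∑ t ∈ range T, deficit d (x t) with hA
    set ν := ∑ t ∈ range T, (1 / T : ℝ) • μ t
    have hνX : ν ∈ Γ.X none := by
      refine (convex_X none).sum_mem (fun t _ => by positivity) ?_ fun t ht => hμ t (mem_range.1 ht)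
      rw [sum_const, card_range, nsmul_eq_mul]
      field_simp
    have hA0 : 0 ≤ A :=
      mul_nonneg (by positivity) (sum_nonneg fun t ht => deficit_nonneg hd (hx t (mem_range.1 ht)))
    obtain ⟨s', hs', hB⟩ := hbr ν hνX
    have k₁ := regret_tradeoff hT hx hmed hpl hopt.1 hdX
    have k₂ := regret_tradeoff hT hx hmed hpl hopt.1 (seqForm_mem_XX s')
    have k₃ := hthr.um_le (by linarith) hdX hopt hνX hs'
    have hdd : deficit d d = 0 := by simp [deficit]
    rw [devGain_self, hdd, sub_zero, add_zero, hε, hα, hlam] at k₁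
    rw [hε, hα, hlam] at k₂
    obtain ⟨hA5, hΔ⟩ := steering_arithmetic hκ hκ1 hN1 hL hcase hA0 (hN ▸ hB) k₁ k₂ (by linarith)
    have hNA : N * A ≤ 5 * L * (N * κ) := by nlinarith
    have hκN : κ ≤ L * (N * κ) := by
      have : 1 ≤ L * N := one_le_mul_of_one_le_of_one_le hL hN1
      nlinarith
    refine ⟨fun i => ?_, ?_, ?_⟩
    · have : Γ.averagePayment d α T μ x i ≤ 1 / T * ∑ t ∈ range T, (α * N + N * deficit d (x t)) :=
        hmono fun t ht => (payment_le hΓ hd (hμ t ht) (hx t ht) hα0 i).trans (by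
          rw [← hN]
          exact add_le_add_right (mul_le_mul_of_nonneg_left (min_le_right _ _) hN0.le) _)
      have e : 1 / (T : ℝ) * ∑ t ∈ range T, (α * N + N * deficit d (x t)) = α * N + N * A := by
        rw [sum_add_distrib, sum_const, card_range, nsmul_eq_mul, ← mul_sum, hA]
        field_simp
      rw [e, hαN] at this
      linarith
    · have := directnessGap_le hT (c := fun t => deficit d (x t)) fun t ht z =>
        abs_prod_at'_sub_le hd (hx t ht) univ z
      rw [← hN] at this
      linarith
    · have h₁ : 1 / (T : ℝ) * ∑ t ∈ range T, Γ.um none (μ t) d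
          ≤ 1 / T * ∑ t ∈ range T, (Γ.um none (μ t) (x t) + N * deficit d (x t)) :=
        hmono fun t ht => by
          have := um_sub_le hΓ hd none (hμ t ht) (hx t ht)
          rw [← hN] at this
          linarith
      have e : 1 / (T : ℝ) * ∑ t ∈ range T, (Γ.um none (μ t) (x t) + N * deficit d (x t))
          = 1 / T * ∑ t ∈ range T, Γ.um none (μ t) (x t) + N * A := by
        rw [sum_add_distrib, ← mul_sum, hA]
        ring
      rw [um_sum, ← mul_sum] at hΔ
      unfold optimalityGap
      linarith
  · have hNκ : N < 2 * L * κ := by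
      rw [not_le, div_lt_iff₀ hκ] at hcase
      exact hcase
    have hbig : 3 * N ≤ 7 * L * (N * κ) := by nlinarith
    refine ⟨fun i => ?_, ?_, ?_⟩
    · refine (havg fun t ht => ?_ : Γ.averagePayment d α T μ x i ≤ 3 * N).trans hbig
      have h₁ := payment_le hΓ hd (hμ t ht) (hx t ht) hα0 i
      rw [← hN, hαN] at h₁
      have h₂ := mul_le_mul_of_nonneg_left (min_le_left 1 (deficit d (x t))) hN0.le
      linarith
    · have := directnessGap_le hT (c := fun _ => 1) fun t ht z =>
        abs_prod_at'_sub_le_one hdX (hx t ht) univ z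
      have h₁ := havg (f := fun _ => 1) (c := 1) fun _ _ => le_rfl
      rw [← hN] at this
      nlinarith
    · have h₁ := (um_mem_Icc hΓ none hopt.1.1 hdX).2
      have h₂ : 0 ≤ 1 / (T : ℝ) * ∑ t ∈ range T, Γ.um none (μ t) (x t) :=
        mul_nonneg (by positivity) (sum_nonneg fun t ht =>
          (um_mem_Icc hΓ none (hμ t (mem_range.1 ht)) (hx t (mem_range.1 ht))).1)
      rw [← hN] at h₁
      unfold optimalityGap
      linarith

end Steering

end EFG

/-! ### The tree of the augmented game -/

section Augment

open GameTree AugInfoset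

variable {I : Type} {A : I → Type} {P : Type} {owner : I → P}

theorem AugInfoset.owner_mediator (h : List (ℕ ⊕ ((J : I) × A J))) (J : I) :
    (mediator h J).owner owner = none := rfl

theorem AugInfoset.owner_player (J : I) (past : List ((K : I) × (Option (A K) × A K)))
    (adv : Option (A J)) : (player J past adv).owner owner = some (owner J) := rfl

theorem augmentTree_decision_of_lt {J : I} {next : A J → GameTree I A P}
    {obj : (decision J next).Leaf → ℝ} {h : List (ℕ ⊕ ((J : I) × A J))}
    {past : P → List ((K : I) × (Option (A K) × A K))} {D : Finset P} (hD : D.card < 2) :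
    augmentTree owner (decision J next) obj h past D = open Classical in
      decision (mediator h J) fun (r : A J) => decision (player J (past (owner J)) (some r))
        fun (a : A J) => augmentTree owner (next a) (fun z => obj ⟨a, z⟩)
          (h ++ [.inr ⟨J, r⟩, .inr ⟨J, a⟩])
          (Function.update past (owner J) (past (owner J) ++ [⟨J, some r, a⟩]))
          (if a = r then D else insert (owner J) D) := by
  rw [augmentTree, if_pos hD]

theorem augmentTree_decision_of_not_lt {J : I} {next : A J → GameTree I A P}
    {obj : (decision J next).Leaf → ℝ} {h : List (ℕ ⊕ ((J : I) × A J))}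
    {past : P → List ((K : I) × (Option (A K) × A K))} {D : Finset P} (hD : ¬ D.card < 2) :
    augmentTree owner (decision J next) obj h past D = open Classical in
      decision (player J (past (owner J)) none)
        fun (a : A J) => augmentTree owner (next a) (fun z => obj ⟨a, z⟩) (h ++ [.inr ⟨J, a⟩])
          (Function.update past (owner J) (past (owner J) ++ [⟨J, none, a⟩])) D := by
  rw [augmentTree, if_neg hD]

theorem augmentTree_payoff_mem {s : Set ℝ} (t : GameTree I A P) (obj : t.Leaf → ℝ)
    (h : List (ℕ ⊕ ((J : I) × A J))) (past : P → List ((K : I) × (Option (A K) × A K)))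
    (D : Finset P) (ht : ∀ z i, t.payoff z i ∈ s) (hobj : ∀ z, obj z ∈ s) (k : Option P)
    (z : (augmentTree owner t obj h past D).Leaf) :
    (augmentTree owner t obj h past D).payoff z k ∈ s := by
  induction t generalizing h past D with
  | leaf v =>
    cases k with
    | none => exact hobj ()
    | some i => exact ht () i
  | chance p next ih =>
    exact ih z.1 _ _ _ _ (fun w => ht ⟨z.1, w⟩) (fun w => hobj ⟨z.1, w⟩) z.2
  | decision J next ih =>
    revert z
    by_cases hD : D.card < 2
    · rw [augmentTree_decision_of_lt hD]
      exact fun z => ih z.2.1 _ _ _ _ (fun w => ht ⟨_, w⟩) (fun w => hobj ⟨_, w⟩) z.2.2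
    · rw [augmentTree_decision_of_not_lt hD]
      exact fun z => ih z.1 _ _ _ _ (fun w => ht ⟨_, w⟩) (fun w => hobj ⟨_, w⟩) z.2

-- Leaf types change when a tree is rewritten, whereas paths are lists of a fixed type; statements
-- about play in the augmented tree are therefore phrased as membership in `paths`.
open Classical in
theorem mem_paths_augmentTree_of_lt {J : I} {next : A J → GameTree I A P}
    {obj : (decision J next).Leaf → ℝ} {h : List (ℕ ⊕ ((J : I) × A J))}
    {past : P → List ((K : I) × (Option (A K) × A K))} {D : Finset P} (hD : D.card < 2)
    {l : List ((J : AugInfoset I A) × A J.base)} :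
    l ∈ (augmentTree owner (decision J next) obj h past D).paths ↔ ∃ r a : A J,
      ∃ m ∈ (augmentTree owner (next a) (fun z => obj ⟨a, z⟩) (h ++ [.inr ⟨J, r⟩, .inr ⟨J, a⟩])
          (Function.update past (owner J) (past (owner J) ++ [⟨J, some r, a⟩]))
          (if a = r then D else insert (owner J) D)).paths,
        l = ⟨mediator h J, r⟩ :: ⟨player J (past (owner J)) (some r), a⟩ :: m := by
  rw [augmentTree_decision_of_lt hD]
  refine mem_paths_decision.trans ?_
  constructor
  · rintro ⟨r, l', hl', rfl⟩
    obtain ⟨a, m, hm, rfl⟩ := mem_paths_decision.1 hl'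
    exact ⟨r, a, m, hm, rfl⟩
  · rintro ⟨r, a, m, hm, rfl⟩
    exact ⟨r, _, mem_paths_decision.2 ⟨a, m, hm, rfl⟩, rfl⟩

open Classical in
theorem mem_paths_augmentTree_of_not_lt {J : I} {next : A J → GameTree I A P}
    {obj : (decision J next).Leaf → ℝ} {h : List (ℕ ⊕ ((J : I) × A J))}
    {past : P → List ((K : I) × (Option (A K) × A K))} {D : Finset P} (hD : ¬ D.card < 2)
    {l : List ((J : AugInfoset I A) × A J.base)} :
    l ∈ (augmentTree owner (decision J next) obj h past D).paths ↔ ∃ a : A J,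
      ∃ m ∈ (augmentTree owner (next a) (fun z => obj ⟨a, z⟩) (h ++ [.inr ⟨J, a⟩])
          (Function.update past (owner J) (past (owner J) ++ [⟨J, none, a⟩])) D).paths,
        l = ⟨player J (past (owner J)) none, a⟩ :: m := by
  rw [augmentTree_decision_of_not_lt hD]
  exact mem_paths_decision

theorem mem_paths_augmentTree_chance {k : ℕ} {p : stdSimplex ℝ (Fin k)}
    {next : Fin k → GameTree I A P} {obj : (chance p next).Leaf → ℝ}
    {h : List (ℕ ⊕ ((J : I) × A J))} {past : P → List ((K : I) × (Option (A K) × A K))}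
    {D : Finset P} {l : List ((J : AugInfoset I A) × A J.base)} :
    l ∈ (augmentTree owner (chance p next) obj h past D).paths ↔ ∃ c,
      l ∈ (augmentTree owner (next c) (fun z => obj ⟨c, z⟩) (h ++ [.inl c.1]) past D).paths := by
  rw [augmentTree, mem_paths_chance]

theorem paths_augmentTree_leaf {v : P → ℝ} {obj : (leaf v : GameTree I A P).Leaf → ℝ}
    {h : List (ℕ ⊕ ((J : I) × A J))} {past : P → List ((K : I) × (Option (A K) × A K))}
    {D : Finset P} : (augmentTree owner (leaf v) obj h past D).paths = {[]} := by
  rw [augmentTree, paths_leaf]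

/-- Player `i` follows all recommendations on the path `l`. -/
def Obeys (owner : I → P) (i : P) (l : List ((J : AugInfoset I A) × A J.base)) : Prop :=
  ∀ (J : I) (past : List ((K : I) × (Option (A K) × A K))) (r a : A J),
    (⟨player J past (some r), a⟩ : (J : AugInfoset I A) × A J.base) ∈ l → owner J = i → a = r

theorem Obeys.of_cons {i : P} {p : (J : AugInfoset I A) × A J.base}
    {l : List ((J : AugInfoset I A) × A J.base)} (h : Obeys owner i (p :: l)) : Obeys owner i l :=
  fun J past r a hp => h J past r a (List.mem_cons_of_mem _ hp)

/-- No recommendations are given once two players have disobeyed. -/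
theorem not_mem_path_of_not_lt (t : GameTree I A P) (obj : t.Leaf → ℝ)
    (h : List (ℕ ⊕ ((J : I) × A J))) (past : P → List ((K : I) × (Option (A K) × A K)))
    {D : Finset P} (hD : ¬ D.card < 2) {l : List ((J : AugInfoset I A) × A J.base)}
    (hl : l ∈ (augmentTree owner t obj h past D).paths) (J : I)
    (past' : List ((K : I) × (Option (A K) × A K))) (r a : A J) :
    (⟨player J past' (some r), a⟩ : (J : AugInfoset I A) × A J.base) ∉ l := by
  induction t generalizing h past l with
  | leaf v =>
    rw [paths_augmentTree_leaf, Set.mem_singleton_iff] at hl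
    simp [hl]
  | chance p next ih =>
    obtain ⟨c, hc⟩ := mem_paths_augmentTree_chance.1 hl
    exact ih c _ _ _ hc
  | decision J' next ih =>
    obtain ⟨b, m, hm, rfl⟩ := (mem_paths_augmentTree_of_not_lt hD).1 hl
    rw [List.mem_cons, not_or]
    refine ⟨fun e => ?_, ih b _ _ _ hm⟩
    have := congrArg Sigma.fst e
    simp only [player.injEq] at this
    obtain ⟨rfl, -, h'⟩ := this
    simp at h'

/-- If only player `i` ever disobeys, then recommendations are always given. -/
theorem not_mem_path_none (i : P) (t : GameTree I A P) (obj : t.Leaf → ℝ)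
    (h : List (ℕ ⊕ ((J : I) × A J))) (past : P → List ((K : I) × (Option (A K) × A K)))
    {D : Finset P} (hD : D ⊆ {i}) {l : List ((J : AugInfoset I A) × A J.base)}
    (hl : l ∈ (augmentTree owner t obj h past D).paths) (ho : ∀ j ≠ i, Obeys owner j l) (J : I)
    (past' : List ((K : I) × (Option (A K) × A K))) (a : A J) :
    (⟨player J past' none, a⟩ : (J : AugInfoset I A) × A J.base) ∉ l := by
  classical
  induction t generalizing h past D l with
  | leaf v =>
    rw [paths_augmentTree_leaf, Set.mem_singleton_iff] at hl
    simp [hl]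
  | chance p next ih =>
    obtain ⟨c, hc⟩ := mem_paths_augmentTree_chance.1 hl
    exact ih c _ _ _ hD hc ho
  | decision J' next ih =>
    have hc : D.card < 2 := by
      have := card_le_card hD
      rw [card_singleton] at this
      omega
    obtain ⟨r, b, m, hm, rfl⟩ := (mem_paths_augmentTree_of_lt hc).1 hl
    rw [List.mem_cons, List.mem_cons, not_or, not_or]
    refine ⟨fun e => ?_, fun e => ?_, ih b _ _ _ ?_ hm fun j hj => (ho j hj).of_cons.of_cons⟩
    · have := congrArg Sigma.fst e
      simp at this
    · have := congrArg Sigma.fst e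
      simp only [player.injEq] at this
      obtain ⟨rfl, -, h'⟩ := this
      simp at h'
    · split_ifs with hb
      · exact hD
      · refine insert_subset ?_ hD
        rw [mem_singleton]
        by_contra hne
        exact hb (ho _ hne J' _ r b (List.mem_cons_of_mem _ List.mem_cons_self) rfl)

/-! ### Reconstructing a sequence from the actions taken -/

open Classical in
/-- The decision of the original game that underlies `p`, if it is one of player `i`, and whether a
recommendation was given. -/
noncomputable def underlying (owner : I → P) (i : P) :
    ((J : AugInfoset I A) × A J.base) → Option ((J : I) × (A J × Bool))
  | ⟨mediator _ _, _⟩ => none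
  | ⟨player J _ adv, a⟩ => if owner J = i then some ⟨J, a, adv.isSome⟩ else none

theorem underlying_mediator (i : P) (h : List (ℕ ⊕ ((J : I) × A J))) (J : I) (r : A J) :
    underlying owner i ⟨mediator h J, r⟩ = none := rfl

open Classical in
theorem underlying_player (i : P) (J : I) (past : List ((K : I) × (Option (A K) × A K)))
    (adv : Option (A J)) (a : A J) : underlying owner i ⟨player J past adv, a⟩ =
      if owner J = i then some ⟨J, a, adv.isSome⟩ else none := rfl

/-- The sequence of an obedient player with the given underlying decisions. -/
def rebuild (past : List ((K : I) × (Option (A K) × A K))) :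
    List ((J : I) × (A J × Bool)) → List ((J : AugInfoset I A) × A J.base)
  | [] => []
  | ⟨J, a, b⟩ :: m => ⟨player J past (if b then some a else none), a⟩ ::
      rebuild (past ++ [⟨J, if b then some a else none, a⟩]) m

-- An obedient player's recommendation equals its action whenever one is given, and its private
-- record consists of its own earlier decisions. Hence its sequence carries no information beyond
-- its decisions and the flags telling whether advice was given.
open Classical in
theorem filter_eq_rebuild (i : P) (t : GameTree I A P) (obj : t.Leaf → ℝ)
    (h : List (ℕ ⊕ ((J : I) × A J))) (past : P → List ((K : I) × (Option (A K) × A K)))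
    (D : Finset P) {l : List ((J : AugInfoset I A) × A J.base)}
    (hl : l ∈ (augmentTree owner t obj h past D).paths) (ho : Obeys owner i l) :
    l.filter (fun p => AugInfoset.owner owner p.1 = some i)
      = rebuild (past i) (l.filterMap (underlying owner i)) := by
  induction t generalizing h past D l with
  | leaf v =>
    rw [paths_augmentTree_leaf, Set.mem_singleton_iff] at hl
    simp [hl, rebuild]
  | chance p next ih =>
    obtain ⟨c, hc⟩ := mem_paths_augmentTree_chance.1 hl
    exact ih c _ _ _ _ hc ho
  | decision J next ih =>
    by_cases hD : D.card < 2
    · obtain ⟨r, a, m, hm, rfl⟩ := (mem_paths_augmentTree_of_lt hD).1 hl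
      have hi := ih a _ _ _ _ hm ho.of_cons.of_cons
      by_cases hJ : owner J = i
      · subst hJ
        obtain rfl := ho J _ r a (List.mem_cons_of_mem _ List.mem_cons_self) rfl
        simp only [Function.update_self] at hi
        simp [owner_mediator, owner_player, List.filterMap_cons, underlying, rebuild, hi]
      · rw [Function.update_of_ne (Ne.symm hJ)] at hi
        simp [owner_mediator, owner_player, List.filterMap_cons, underlying, hJ, hi]
    · obtain ⟨a, m, hm, rfl⟩ := (mem_paths_augmentTree_of_not_lt hD).1 hl
      have hi := ih a _ _ _ _ hm ho.of_cons
      by_cases hJ : owner J = i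
      · subst hJ
        simp only [Function.update_self] at hi
        simp [owner_player, underlying, rebuild, hi]
      · rw [Function.update_of_ne (Ne.symm hJ)] at hi
        simp [owner_player, underlying, hJ, hi]

/-! ### Shifting the blame for disobedience -/

open Classical in
/-- The first player who disobeys a recommendation. -/
noncomputable def firstDisobedient (owner : I → P) :
    List ((J : AugInfoset I A) × A J.base) → Option P
  | [] => none
  | ⟨mediator _ _, _⟩ :: l => firstDisobedient owner l
  | ⟨player _ _ none, _⟩ :: l => firstDisobedient owner l
  | ⟨player J _ (some r), a⟩ :: l => if a = r then firstDisobedient owner l else some (owner J)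

theorem firstDisobedient_mediator (h : List (ℕ ⊕ ((J : I) × A J))) (J : I) (r : A J)
    (l : List ((J : AugInfoset I A) × A J.base)) :
    firstDisobedient owner (⟨mediator h J, r⟩ :: l) = firstDisobedient owner l := rfl

open Classical in
theorem firstDisobedient_player (J : I) (past : List ((K : I) × (Option (A K) × A K))) (r a : A J)
    (l : List ((J : AugInfoset I A) × A J.base)) :
    firstDisobedient owner (⟨player J past (some r), a⟩ :: l)
      = if a = r then firstDisobedient owner l else some (owner J) := rfl

/-- Once advice has stopped, histories and records only affect labels, which `underlying` forgets.
-/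
theorem exists_path_of_not_lt (i : P) (t : GameTree I A P) (obj : t.Leaf → ℝ)
    {h h' : List (ℕ ⊕ ((J : I) × A J))} {past past' : P → List ((K : I) × (Option (A K) × A K))}
    {D D' : Finset P} (hD : ¬ D.card < 2) (hD' : ¬ D'.card < 2)
    {l : List ((J : AugInfoset I A) × A J.base)}
    (hl : l ∈ (augmentTree owner t obj h past D).paths) :
    ∃ l' ∈ (augmentTree owner t obj h' past' D').paths,
      l'.filterMap (underlying owner i) = l.filterMap (underlying owner i) := by
  induction t generalizing h h' past past' l with
  | leaf v =>
    rw [paths_augmentTree_leaf] at hl ⊢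
    exact ⟨l, hl, rfl⟩
  | chance p next ih =>
    obtain ⟨c, hc⟩ := mem_paths_augmentTree_chance.1 hl
    obtain ⟨l', hl', e⟩ := ih c _ hc
    exact ⟨l', mem_paths_augmentTree_chance.2 ⟨c, hl'⟩, e⟩
  | decision J next ih =>
    obtain ⟨a, m, hm, rfl⟩ := (mem_paths_augmentTree_of_not_lt hD).1 hl
    obtain ⟨m', hm', e⟩ := ih a _ hm
    refine ⟨_, (mem_paths_augmentTree_of_not_lt hD').2 ⟨a, m', hm', rfl⟩, ?_⟩
    simp only [List.filterMap_cons, underlying_player, e]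

/-- An obedient player may be marked as disobedient in place of the first disobedient player. -/
theorem exists_path_of_singleton (i : P) (t : GameTree I A P) (obj : t.Leaf → ℝ)
    {h h' : List (ℕ ⊕ ((J : I) × A J))} {past past' : P → List ((K : I) × (Option (A K) × A K))}
    {D : Finset P} (hD : D.card < 2) (hi : i ∉ D)
    {l : List ((J : AugInfoset I A) × A J.base)}
    (hl : l ∈ (augmentTree owner t obj h past D).paths) (ho : Obeys owner i l) :
    ∃ l' ∈ (augmentTree owner t obj h' past' {i}).paths,
      l'.filterMap (underlying owner i) = l.filterMap (underlying owner i) := by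
  classical
  have h1 : ({i} : Finset P).card < 2 := by simp
  induction t generalizing h h' past past' l D with
  | leaf v =>
    rw [paths_augmentTree_leaf] at hl ⊢
    exact ⟨l, hl, rfl⟩
  | chance p next ih =>
    obtain ⟨c, hc⟩ := mem_paths_augmentTree_chance.1 hl
    obtain ⟨l', hl', e⟩ := ih c _ hD hi hc ho
    exact ⟨l', mem_paths_augmentTree_chance.2 ⟨c, hl'⟩, e⟩
  | decision J next ih =>
    obtain ⟨r, a, m, hm, rfl⟩ := (mem_paths_augmentTree_of_lt hD).1 hl
    suffices ∃ r' : A J, ∃ m' ∈ (augmentTree owner (next a) (fun z => obj ⟨a, z⟩)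
        (h' ++ [.inr ⟨J, r'⟩, .inr ⟨J, a⟩])
        (Function.update past' (owner J) (past' (owner J) ++ [⟨J, some r', a⟩]))
        (if a = r' then {i} else insert (owner J) {i})).paths,
        m'.filterMap (underlying owner i) = m.filterMap (underlying owner i) by
      obtain ⟨r', m', hm', e⟩ := this
      refine ⟨_, (mem_paths_augmentTree_of_lt h1).2 ⟨r', a, m', ?_, rfl⟩, ?_⟩
      · convert hm'
      · simp only [List.filterMap_cons, underlying_mediator, underlying_player, e,
          Option.isSome_some]
    -- In the new tree disobedience is hidden by recommending `a` itself. The exception is the step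
    -- at which a second player disobeys in `l`: it is kept, so that with `i` already marked advice
    -- stops at the same moment on both paths and the flags agree.
    by_cases ha : a = r
    · rw [if_pos ha] at hm
      obtain ⟨m', hm', e⟩ := ih a _ hD hi hm ho.of_cons.of_cons
      exact ⟨a, m', by rwa [if_pos rfl], e⟩
    · rw [if_neg ha] at hm
      have hJ : owner J ≠ i := fun hJ => ha (ho J _ r a (List.mem_cons_of_mem _ List.mem_cons_self) hJ)
      by_cases hc : (insert (owner J) D).card < 2
      · obtain ⟨m', hm', e⟩ := ih a _ hc (by simp [hi, Ne.symm hJ]) (by convert hm)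
          ho.of_cons.of_cons
        exact ⟨a, m', by rwa [if_pos rfl], e⟩
      · have hc' : ¬ (insert (owner J) {i} : Finset P).card < 2 := by
          rw [card_insert_of_notMem (by simpa using hJ)]
          simp
        obtain ⟨m', hm', e⟩ := exists_path_of_not_lt i _ _ hc hc' (by convert hm)
        exact ⟨r, m', by rwa [if_neg ha], e⟩

/-- A path on which player `i` follows all recommendations, at least one of them nontrivial, corresponds
to one with the same underlying decisions of player `i` on which `i` is the first to disobey. -/
theorem exists_path_firstDisobedient (i : P) (t : GameTree I A P) (obj : t.Leaf → ℝ)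
    {h h' : List (ℕ ⊕ ((J : I) × A J))} {past past' : P → List ((K : I) × (Option (A K) × A K))}
    {D : Finset P} (hD : D.card < 2) (hi : i ∉ D)
    {l : List ((J : AugInfoset I A) × A J.base)}
    (hl : l ∈ (augmentTree owner t obj h past D).paths) (ho : Obeys owner i l) {K : I}
    {pastK : List ((K : I) × (Option (A K) × A K))} {rK aK bK : A K} (hb : bK ≠ aK)
    (hK : owner K = i)
    (hmem : (⟨player K pastK (some rK), aK⟩ : (J : AugInfoset I A) × A J.base) ∈ l) :
    ∃ l' ∈ (augmentTree owner t obj h' past' ∅).paths, firstDisobedient owner l' = some i ∧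
      l'.filterMap (underlying owner i) = l.filterMap (underlying owner i) := by
  classical
  have h0 : (∅ : Finset P).card < 2 := by simp
  induction t generalizing h h' past past' l D with
  | leaf v =>
    rw [paths_augmentTree_leaf, Set.mem_singleton_iff] at hl
    simp [hl] at hmem
  | chance p next ih =>
    obtain ⟨c, hc⟩ := mem_paths_augmentTree_chance.1 hl
    obtain ⟨l', hl', e⟩ := ih c _ hD hi hc ho hmem
    exact ⟨l', mem_paths_augmentTree_chance.2 ⟨c, hl'⟩, e⟩
  | decision J next ih =>
    obtain ⟨r, a, m, hm, rfl⟩ := (mem_paths_augmentTree_of_lt hD).1 hl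
    suffices ∃ r' : A J, ∃ m' ∈ (augmentTree owner (next a) (fun z => obj ⟨a, z⟩)
        (h' ++ [.inr ⟨J, r'⟩, .inr ⟨J, a⟩])
        (Function.update past' (owner J) (past' (owner J) ++ [⟨J, some r', a⟩]))
        (if a = r' then ∅ else insert (owner J) ∅)).paths,
        (if a = r' then firstDisobedient owner m' else some (owner J)) = some i ∧
        m'.filterMap (underlying owner i) = m.filterMap (underlying owner i) by
      obtain ⟨r', m', hm', hf, e⟩ := this
      refine ⟨_, (mem_paths_augmentTree_of_lt h0).2 ⟨r', a, m', ?_, rfl⟩, ?_, ?_⟩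
      · convert hm'
      · rw [firstDisobedient_mediator, firstDisobedient_player]
        convert hf
      · simp only [List.filterMap_cons, underlying_mediator, underlying_player, e,
          Option.isSome_some]
    -- If `i` has no choice at the current node, or does not move there, the decision at `K` lies
    -- further down, because an alternative `bK` exists at `K`.
    have hmem' : (owner J = i → ∀ b, b = a) →
        (⟨player K pastK (some rK), aK⟩ : (J : AugInfoset I A) × A J.base) ∈ m := by
      intro hJ
      rcases List.mem_cons.1 hmem with e | hmem'
      · have := congrArg Sigma.fst e
        simp at this
      rcases List.mem_cons.1 hmem' with e | hmem'
      · have h₁ := congrArg Sigma.fst e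
        simp only [player.injEq] at h₁
        obtain ⟨rfl, rfl, h₂⟩ := h₁
        obtain rfl := Option.some.inj (eq_of_heq h₂)
        obtain rfl := eq_of_heq (Sigma.mk.inj e).2
        exact absurd (hJ hK bK) hb
      · exact hmem'
    by_cases hJ : owner J = i
    · have ha : a = r := ho J _ r a (List.mem_cons_of_mem _ List.mem_cons_self) hJ
      rw [if_pos ha] at hm
      -- At the first genuine choice of `i` the mediator recommends some `b ≠ a` instead; up to
      -- there everybody has been made obedient, so `i` is the first to disobey.
      by_cases hex : ∃ b, b ≠ a
      · obtain ⟨b, hba⟩ := hex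
        obtain ⟨m', hm', e⟩ := exists_path_of_singleton i _ _ hD hi hm ho.of_cons.of_cons
        refine ⟨b, m', ?_, by rw [if_neg hba.symm, hJ], e⟩
        rw [if_neg hba.symm, hJ]
        convert hm'
        ext
        simp
      · push Not at hex
        obtain ⟨m', hm', hf, e⟩ := ih a _ hD hi hm ho.of_cons.of_cons (hmem' fun _ => hex)
        exact ⟨a, m', by rwa [if_pos rfl], by rwa [if_pos rfl], e⟩
    · have hmem'' := hmem' fun h => absurd h hJ
      by_cases hc : (if a = r then D else insert (owner J) D).card < 2
      · obtain ⟨m', hm', hf, e⟩ := ih a _ hc (by split_ifs <;> simp [hi, Ne.symm hJ])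
          (by convert hm) ho.of_cons.of_cons hmem''
        exact ⟨a, m', by rwa [if_pos rfl], by rwa [if_pos rfl], e⟩
      -- Advice cannot have stopped already, since a recommendation at `K` is still to come.
      · exact absurd hmem'' (not_mem_path_of_not_lt _ _ _ _ hc (by convert hm) _ _ _ _)

/-! ### Unilateral deviations in the augmented game -/

/-- The information sets of a tree. -/
def GameTree.infosets : GameTree I A P → Set I
  | leaf _ => ∅
  | chance _ next => ⋃ c, infosets (next c)
  | decision J next => insert J (⋃ a, infosets (next a))

theorem GameTree.finite_infosets [∀ J, Finite (A J)] (t : GameTree I A P) : t.infosets.Finite := by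
  induction t with
  | leaf u => exact Set.finite_empty
  | chance p next ih => exact Set.finite_iUnion ih
  | decision J next ih => exact (Set.finite_iUnion ih).insert J

/-- The private record that results from a sequence of the original game if the recommendations were
those of `q`. -/
def recordOf (q : ∀ J, A J) (r : List ((J : I) × A J)) : List ((K : I) × (Option (A K) × A K)) :=
  r.map fun p => ⟨p.1, some (q p.1), p.2⟩

open Classical in
/-- If the mediator recommends the pure profile `π` and all players but `i` obey, then play proceeds as
in the original game under the profile `π'`. -/
theorem val_augmentTree (i k : P) (S : ∀ J : AugInfoset I A, A J.base) (π q π' : ∀ J, A J)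
    (rec : I → List ((J : I) × A J)) (hmed : ∀ h J, S (mediator h J) = π J)
    (hob : ∀ J past r, owner J ≠ i → S (player J past (some r)) = r)
    (hq : ∀ J, owner J = i → π J = q J) (hπ : ∀ J, owner J ≠ i → π' J = π J)
    (t : GameTree I A P) (obj : t.Leaf → ℝ) (h : List (ℕ ⊕ ((J : I) × A J)))
    (past : P → List ((K : I) × (Option (A K) × A K))) {D : Finset P} (hD : D ⊆ {i})
    (r : List ((J : I) × A J)) (hpast : past i = recordOf q r)
    (hrec : ∀ J r', (J, r') ∈ t.records owner i r → r' = rec J)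
    (hπi : ∀ J ∈ t.infosets, owner J = i → π' J = S (player J (recordOf q (rec J)) (some (q J)))) :
    GameTree.val (some k) S (augmentTree owner t obj h past D) = GameTree.val k π' t := by
  induction t generalizing h past D r with
  | leaf v => rfl
  | chance p next ih =>
    rw [augmentTree, GameTree.val, GameTree.val]
    refine sum_congr rfl fun c _ => ?_
    rw [ih c _ _ _ hD r hpast (fun J r' h' => hrec J r' (Set.mem_iUnion.2 ⟨c, h'⟩))
      fun J hJ => hπi J (Set.mem_iUnion.2 ⟨c, hJ⟩)]
  | decision J next ih =>
    have hc : D.card < 2 := by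
      have := card_le_card hD
      rw [card_singleton] at this
      omega
    have hsub : ∀ a K, K ∈ (next a).infosets → owner K = i →
        π' K = S (player K (recordOf q (rec K)) (some (q K))) := fun a K hK =>
      hπi K (Set.mem_insert_of_mem _ (Set.mem_iUnion.2 ⟨a, hK⟩))
    have hJ' := hπi J (Set.mem_insert _ _)
    rw [augmentTree_decision_of_lt hc]
    change GameTree.val (some k) S (augmentTree owner
      (next (S (player J (past (owner J)) (some (S (mediator h J)))))) _ _ _ _)
        = GameTree.val k π' (next (π' J))
    rw [hmed]
    by_cases hJ : owner J = i
    · have hr : r = rec J := hrec J r (by simp [records, hJ])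
      -- Perfect recall enters through `rec`: the record at `J`, and so the augmented information
      -- set above `J`, depends only on `J` and `q`.
      have hS : S (player J (past (owner J)) (some (π J))) = π' J := by
        rw [hJ' hJ, hJ, hpast, hr, hq J hJ]
      rw [hS]
      refine ih _ _ _ _ ?_ (r ++ [⟨J, π' J⟩]) ?_ (fun K r' h' => hrec K r' ?_) (hsub _)
      · split_ifs
        · exact hD
        · exact insert_subset (by simp [hJ]) hD
      · rw [hJ, Function.update_self, hpast, hq J hJ]
        simp [recordOf]
      · simp only [records, hJ, if_true]
        exact Or.inr (Set.mem_iUnion.2 ⟨_, h'⟩)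
    · rw [hob _ _ _ hJ, hπ J hJ, if_pos rfl]
      refine ih _ _ _ _ hD r ?_ (fun K r' h' => hrec K r' ?_) (hsub _)
      · rw [Function.update_of_ne (Ne.symm hJ), hpast]
      · simp only [records, hJ, if_false]
        exact Set.mem_iUnion.2 ⟨_, h'⟩

end Augment

namespace EFG

open GameTree AugInfoset

theorem seqForm_eq_one_iff {P : Type} {G : EFG P} {i : P} (s : G.Pure i) (σ : G.Seqs i) :
    G.seqForm s σ = 1 ↔ ∀ (J : G.Infoset) (a : G.Act J) (h : G.owner J = i),
      ⟨J, a⟩ ∈ σ.1 → s ⟨J, h⟩ = a := by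
  unfold seqForm
  split_ifs with h
  · exact iff_of_true rfl h
  · exact iff_of_false zero_ne_one h

variable {n : ℕ} {G : EFG (Fin n)} {obj : G.Z → ℝ}

/-! ### Existence of equilibria -/

/-- The mediator's strategy that recommends the actions of the pure profile `π`. -/
def recommend (obj : G.Z → ℝ) (π : ∀ J, G.Act J) : (G.augment obj).Pure none := fun J =>
  π (AugInfoset.base J.1)

/-- A lone deviator `s'` acts in the original game as the pure strategy given by `π'` at its
information sets. Separating `q`, the part of the recommendation that `i` sees, from `π` makes this
strategy a function of `i`'s own component, as a correlated-equilibrium deviation must be. -/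
theorem um_recommend {s : (i : Fin n) → (G.augment obj).Pure (some i)}
    (hs : ∀ i, G.IsDirect obj (s i)) {i : Fin n} (s' : (G.augment obj).Pure (some i))
    {π q π' : ∀ J, G.Act J} {rec : G.Infoset → List ((J : G.Infoset) × G.Act J)}
    (hrec : ∀ J r, (J, r) ∈ G.tree.records G.owner i [] → r = rec J)
    (hq : ∀ J, G.owner J = i → π J = q J) (hπ : ∀ J, G.owner J ≠ i → π' J = π J)
    (hπi : ∀ J ∈ G.tree.infosets, ∀ h : G.owner J = i,
      π' J = s' ⟨player J (recordOf q (rec J)) (some (q J)), congrArg some h⟩) :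
    (G.augment obj).um (some i) ((G.augment obj).seqForm (recommend obj π))
      (Function.update (fun j => (G.augment obj).seqForm (s j)) i ((G.augment obj).seqForm s'))
      = G.tree.val i π' := by
  let full : (j : Option (Fin n)) → (G.augment obj).Pure j := fun j => match j with
    | none => recommend obj π
    | some j => Function.update s i s' j
  have hfull : (G.augment obj).um (some i) ((G.augment obj).seqForm (recommend obj π))
      (Function.update (fun j => (G.augment obj).seqForm (s j)) i ((G.augment obj).seqForm s'))
      = (G.augment obj).u (some i) (fun j => (G.augment obj).seqForm (full j)) := by
    unfold um
    congr 1
    funext j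
    cases j with
    | none => rfl
    | some j =>
      by_cases hj : j = i
      · subst hj
        simp only [full, Function.update_self]
      · simp only [full, Function.update_of_ne hj]
  rw [hfull, u_seqForm]
  refine val_augmentTree i i _ π q π' rec (fun _ _ => rfl) (fun J past r hJ => ?_) hq hπ _ obj
    [] (fun _ => []) (empty_subset _) [] rfl hrec fun J hJ hi => ?_
  · change full (some (G.owner J)) ⟨player J past (some r), rfl⟩ = r
    simp only [full, Function.update_of_ne hJ]
    exact hs _ J past r rfl
  · rw [hπi J hJ hi]
    refine Eq.trans ?_ (joint_apply (G := G.augment obj) full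
      (J := player J (recordOf q (rec J)) (some (q J))) (congrArg some hi)).symm
    simp only [full, Function.update_self]
    rfl

theorem PerfectRecall.exists_record {i : Fin n} (h : G.PerfectRecall i) :
    ∃ rec : G.Infoset → List ((J : G.Infoset) × G.Act J),
      ∀ J r, (J, r) ∈ G.tree.records G.owner i [] → r = rec J := by
  have : ∀ J, ∃ r', ∀ r, (J, r) ∈ G.tree.records G.owner i [] → r = r' := fun J => by
    by_cases hJ : ∃ r', (J, r') ∈ G.tree.records G.owner i []
    · obtain ⟨r', hr'⟩ := hJ
      exact ⟨r', fun r hr => h J r r' hr hr'⟩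
    · push Not at hJ
      exact ⟨[], fun r hr => absurd hr (hJ r)⟩
  choose rec hrec using this
  exact ⟨rec, hrec⟩

/-- The mediator draws a profile from a correlated equilibrium of the original game and recommends
it. Each deviation of the augmented game acts on the recommended strategy by a self-map `φ k`,
against which the distribution is protected. -/
theorem exists_isEquilibrium (hrecall : ∀ i, G.PerfectRecall i)
    {s : (i : Fin n) → (G.augment obj).Pure (some i)} (hs : ∀ i, G.IsDirect obj (s i))
    {d : (G.augment obj).Profile} (hd : ∀ i, d i = (G.augment obj).seqForm (s i)) :
    ∃ μ, (G.augment obj).IsEquilibrium d μ := by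
  classical
  obtain rfl : d = fun i => (G.augment obj).seqForm (s i) := funext hd
  choose rec hrec using fun i => (hrecall i).exists_record
  have : Finite G.tree.infosets := G.tree.finite_infosets.to_subtype
  have : Fintype ((J : G.tree.infosets) → G.Act J) := Fintype.ofFinite _
  have : ∀ i : Fin n, Fintype (Set.range ((G.augment obj).seqForm (i := some i))) :=
    fun i => (finite_range_seqForm (some i)).fintype
  -- The type of information sets may be infinite; only those in the tree matter, and restricting to
  -- them makes the set of strategies finite. Likewise deviations are indexed below by the finitely
  -- many sequence forms rather than by pure strategies.
  let ext : ((J : G.tree.infosets) → G.Act J) → ∀ J, G.Act J := fun q J =>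
    if h : J ∈ G.tree.infosets then q ⟨J, h⟩ else Classical.arbitrary _
  have hext : ∀ q J (h : J ∈ G.tree.infosets), ext q J = q ⟨J, h⟩ := fun q J h => dif_pos h
  let joint : (Fin n → ((J : G.tree.infosets) → G.Act J)) → ∀ J, G.Act J := fun p J =>
    ext (p (G.owner J)) J
  let K := (i : Fin n) × Set.range ((G.augment obj).seqForm (i := some i))
  let dev : (k : K) → (G.augment obj).Pure (some k.1) := fun k => k.2.2.choose
  have hdev : ∀ k : K, (G.augment obj).seqForm (dev k) = k.2.1 := fun k => k.2.2.choose_spec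
  let φ : K → ((J : G.tree.infosets) → G.Act J) → (J : G.tree.infosets) → G.Act J :=
    fun k q J => (dev k).extend
      (player J.1 (recordOf (ext q) (rec k.1 J.1)) (some (ext q J.1)))
  obtain ⟨w, hw, hw1, hwk⟩ := exists_correlated_equilibrium (fun k : K => k.1) φ
    fun i p => G.tree.val i (joint p)
  refine ⟨∑ p, w p • (G.augment obj).seqForm (recommend obj (joint p)),
    (convex_X none).sum_mem (fun p _ => hw p) hw1 fun p _ => seqForm_mem_X _, fun i y hy => ?_⟩
  refine le_of_mem_X (isLinearMap_um_update _ _ _ _) (fun s' => ?_) hy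
  rw [← sub_nonpos, um_sum, um_sum, ← sum_sub_distrib]
  refine le_trans (le_of_eq (sum_congr rfl fun p _ => ?_)) (hwk ⟨i, _, s', rfl⟩)
  rw [mul_sub]
  congr 2
  · refine (congrArg (fun v => (G.augment obj).um (some i) _ (Function.update _ i v))
      (hdev ⟨i, _, s', rfl⟩).symm).trans (um_recommend hs _ (q := ext (p i)) (hrec i) (fun J hJ => ?_) (fun J hJ => ?_)
      fun J hJ hi => ?_)
    · simp only [joint, hJ]
    · simp only [joint, Function.update_of_ne hJ]
    · simp only [joint, hi, Function.update_self]
      rw [hext _ _ hJ]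
      exact Pure.extend_apply (G := G.augment obj) (dev ⟨i, _, s', rfl⟩)
        (J := player J (recordOf (ext (p i)) (rec i J)) (some (ext (p i) J))) (congrArg some hi)
  · have h := um_recommend (π := joint p) hs (s i) (q := ext (p i)) (hrec i)
      (fun J hJ => by simp only [joint, hJ]) (fun J _ => rfl) fun J hJ hi => by
        refine Eq.trans ?_ (hs i J _ _ (congrArg some hi)).symm
        simp only [joint, hi]
    rwa [Function.update_eq_self] at h

/-! ### Best responses that are not too far from obedience -/

/-- The decisions on the path to a terminal node of the augmented game. -/
noncomputable def augPath (z : (G.augment obj).Z) :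
    List ((J : AugInfoset G.Infoset G.Act) × G.Act J.base) := (G.augment obj).tree.path z

theorem augPath_mem (z : (G.augment obj).Z) :
    augPath z ∈ (augmentTree G.owner G.tree obj [] (fun _ => []) ∅).paths := ⟨z, rfl⟩

theorem mem_augment_seq_iff {i : Fin n} {z : (G.augment obj).Z}
    {p : (J : AugInfoset G.Infoset G.Act) × G.Act J.base} :
    p ∈ (G.augment obj).seq (some i) z ↔ p ∈ augPath z ∧ p.1.owner G.owner = some i :=
  mem_seq_iff (G := G.augment obj)

theorem obeys_of_seqForm_eq_one {i : Fin n} {s : (G.augment obj).Pure (some i)}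
    (hs : G.IsDirect obj s) {z : (G.augment obj).Z}
    (h : (G.augment obj).seqForm s ⟨(G.augment obj).seq (some i) z, z, rfl⟩ = 1) :
    Obeys G.owner i (augPath z) := fun J past r a hmem hJ => by
  have := (seqForm_eq_one_iff _ _).1 h (player J past (some r)) a (congrArg some hJ)
    (mem_augment_seq_iff.2 ⟨hmem, congrArg some hJ⟩)
  rw [← this]
  exact hs J past r (congrArg some hJ)

open Classical in
/-- The strategy that plays `s'` where a recommendation is given and `s` elsewhere. -/
noncomputable def patch {i : Fin n} (s s' : (G.augment obj).Pure (some i)) :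
    (G.augment obj).Pure (some i) := fun J =>
  if ∃ K past, J.1 = (player K past none : AugInfoset G.Infoset G.Act) then s J else s' J

/-- At a leaf the obedient opponents can reach, at most `i` has disobeyed, so advice was always
given and the patched information sets do not occur. -/
theorem at'_patch {i : Fin n} {s : (j : Fin n) → (G.augment obj).Pure (some j)}
    (hs : ∀ j, G.IsDirect obj (s j)) (s' : (G.augment obj).Pure (some i))
    {z : (G.augment obj).Z}
    (hz : ∀ j ≠ i, (G.augment obj).at' ((G.augment obj).seqForm (s j)) z ≠ 0) :
    (G.augment obj).at' ((G.augment obj).seqForm (patch (s i) s')) z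
      = (G.augment obj).at' ((G.augment obj).seqForm s') z := by
  have ho : ∀ j ≠ i, Obeys G.owner j (augPath z) := fun j hj =>
    obeys_of_seqForm_eq_one (hs j) ((seqForm_eq_zero_or_one _ _).resolve_left (hz j hj))
  have hp : ∀ (J : AugInfoset G.Infoset G.Act) (a : G.Act J.base) (h : J.owner G.owner = some i),
      (⟨J, a⟩ : (J : AugInfoset G.Infoset G.Act) × G.Act J.base) ∈
        (G.augment obj).seq (some i) z → patch (s i) s' ⟨J, h⟩ = s' ⟨J, h⟩ := by
    refine fun J a h hmem => if_neg ?_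
    rintro ⟨K, past, rfl⟩
    exact not_mem_path_none i G.tree obj [] _ (empty_subset _) (augPath_mem z) ho K past a
      (mem_augment_seq_iff.1 hmem).1
  unfold at' seqForm
  congr 1
  refine propext (forall_congr' fun J => forall_congr' fun a => forall_congr' fun h =>
    forall_congr' fun hmem => ?_)
  rw [hp J a h hmem]

/-- The patched strategy agrees with `s` where there is no advice, so it leaves `σ` at a recommended
decision, and its choice there is the alternative action needed to shift the blame onto `i`. -/
theorem exists_firstDisobedient {i : Fin n} {s : (G.augment obj).Pure (some i)}
    (hs : G.IsDirect obj s) (s' : (G.augment obj).Pure (some i)) {σ : (G.augment obj).Seqs (some i)}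
    (h1 : (G.augment obj).seqForm s σ = 1) (h0 : (G.augment obj).seqForm (patch s s') σ = 0) :
    ∃ z : (G.augment obj).Z, firstDisobedient G.owner (augPath z) = some i ∧
      σ.1 = rebuild [] ((augPath z).filterMap (underlying G.owner i)) := by
  obtain ⟨_, z, rfl⟩ := σ
  have ho := obeys_of_seqForm_eq_one hs h1
  have hne : ¬ (G.augment obj).seqForm (patch s s') ⟨(G.augment obj).seq (some i) z, z, rfl⟩ = 1 := by
    rw [h0]
    exact zero_ne_one
  rw [seqForm_eq_one_iff] at h1 hne
  push Not at hne
  obtain ⟨J, a, hJ, hmem, hna⟩ := hne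
  have ha := h1 J a hJ hmem
  have hcase : ∀ (J : AugInfoset G.Infoset G.Act) (a : G.Act J.base)
      (hJ : J.owner G.owner = some i), (⟨J, a⟩ : (J : AugInfoset G.Infoset G.Act) × G.Act J.base) ∈
        (G.augment obj).seq (some i) z → s ⟨J, hJ⟩ = a → patch s s' ⟨J, hJ⟩ ≠ a →
      ∃ l' ∈ (augmentTree G.owner G.tree obj [] (fun _ => []) ∅).paths,
        firstDisobedient G.owner l' = some i ∧
        l'.filterMap (underlying G.owner i) = (augPath z).filterMap (underlying G.owner i) := by
    intro J a hJ hmem ha hna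
    cases J with
    | mediator h K => exact absurd hJ (by simp [AugInfoset.owner])
    | player K past adv =>
      cases adv with
      | none => exact absurd ((if_pos ⟨K, past, rfl⟩).trans ha) hna
      | some r =>
        exact exists_path_firstDisobedient i G.tree obj (by simp) (by simp) (augPath_mem z) ho
          (K := K) (pastK := past) (rK := r) (aK := a) hna (Option.some.inj hJ)
          (mem_augment_seq_iff.1 hmem).1
  obtain ⟨_, ⟨z', rfl⟩, hf, he⟩ := hcase J a hJ hmem ha hna
  refine ⟨z', hf, ?_⟩
  change (G.augment obj).seq (some i) z = rebuild [] (List.filterMap _ (path _ z'))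
  rw [he]
  classical
  refine Eq.trans ?_ (filter_eq_rebuild i G.tree obj [] (fun _ => []) ∅ (augPath_mem z) ho)
  rw [seq, sequence_eq_filter]
  exact List.filter_congr fun p _ => decide_eq_decide.2 Iff.rfl

/-- Patching does not change the deviation payoff against `d`, so it preserves best responses. The
deficit then counts pairs of a player and a lost sequence, which are injected into the leaves. -/
theorem exists_isBestResponse_deficit_le {s : (i : Fin n) → (G.augment obj).Pure (some i)}
    (hs : ∀ i, G.IsDirect obj (s i)) {d : (G.augment obj).Profile}
    (hd : ∀ i, d i = (G.augment obj).seqForm (s i)) (μ : (G.augment obj).Vec none) :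
    ∃ s', (G.augment obj).IsBestResponse d μ s' ∧
      deficit d (fun i => (G.augment obj).seqForm (s' i)) ≤ Fintype.card (G.augment obj).Z := by
  obtain ⟨s', hs'⟩ := exists_isBestResponse d μ
  refine ⟨fun i => patch (s i) (s' i), fun i y hy => (hs' i y hy).trans (le_of_eq ?_), ?_⟩
  · rw [um_update, um_update]
    refine sum_congr rfl fun z _ => ?_
    by_cases hz : ∏ j ∈ univ.erase i, (G.augment obj).at' (d j) z = 0
    · rw [hz, mul_zero, mul_zero, mul_zero]
    · rw [at'_patch hs (s' i) fun j hj => ?_]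
      rw [← hd]
      exact (prod_ne_zero_iff.1 hz) j (mem_erase.2 ⟨hj, mem_univ j⟩)
  · simp only [deficit, hd, seqForm_dotProduct_sub_seqForm]
    rw [← Nat.cast_sum, Nat.cast_le, ← Nat.card_sigma, ← Nat.card_eq_fintype_card]
    choose f hf hfσ using fun (p : (i : Fin n) × {σ : (G.augment obj).Seqs (some i) //
        (G.augment obj).seqForm (s i) σ = 1 ∧ (G.augment obj).seqForm (patch (s i) (s' i)) σ = 0}) =>
      exists_firstDisobedient (hs p.1) (s' p.1) p.2.2.1 p.2.2.2
    -- The first disobedient player at the chosen leaf recovers `i`, and then `rebuild` recovers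
    -- `σ`.
    refine Nat.card_le_card_of_injective f ?_
    intro p p' h
    have h₁ := hf p
    rw [h, hf p'] at h₁
    have h₂ := hfσ p
    have h₃ := hfσ p'
    rw [h] at h₂
    obtain ⟨i, σ, hσ⟩ := p
    obtain ⟨i', σ', hσ'⟩ := p'
    obtain rfl : i' = i := Option.some.inj h₁
    obtain rfl : σ = σ' := Subtype.ext (h₂.trans h₃.symm)
    rfl

end EFG

/-! ### The main theorem -/

theorem mainTheorem4 {n : ℕ} (G : EFG (Fin n)) (obj : G.Z → ℝ)
    (hu : ∀ i z, G.payoff i z ∈ Set.Icc (0 : ℝ) 1)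
    (hobj : ∀ z, obj z ∈ Set.Icc (0 : ℝ) 1)
    (hrecall : ∀ i, G.PerfectRecall i)
    (s : (i : Fin n) → (G.augment obj).Pure (some i))
    (hs : ∀ i, G.IsDirect obj (s i))
    (d : (G.augment obj).Profile)
    (hd : ∀ i, d i = (G.augment obj).seqForm (s i)) :
    (∃ μStar, (G.augment obj).IsOptimal d μStar) ∧
    (∃ lamStar : ℝ, 1 ≤ lamStar ∧ (G.augment obj).IsLagrangeThreshold d lamStar) ∧
    ∀ lamStar : ℝ, 1 ≤ lamStar → (G.augment obj).IsLagrangeThreshold d lamStar →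
      ∀ (R₀ R : ℕ → ℝ) (T : ℕ) (N ε α lam : ℝ),
        N = Fintype.card (G.augment obj).Z →
        ε = (R₀ T + 4 * n * R T) / T →
        0 < ε →
        α = ε ^ (2 / 3 : ℝ) * N ^ (-1 / 3 : ℝ) →
        lam = N ^ (2 / 3 : ℝ) * ε ^ (-1 / 3 : ℝ) →
        α ≤ 1 / N →
        ∀ (alg : List ((G.augment obj).Vec none → ℝ) → (G.augment obj).Vec none)
          (μ : ℕ → (G.augment obj).Vec none) (x : ℕ → (G.augment obj).Profile),
          (G.augment obj).IsOnlineSteerRun d lam alg T μ x →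
          (G.augment obj).MediatorRegretLE d lam T μ x (R₀ T) →
          (∀ i, (G.augment obj).PlayerRegretLE d α T μ x i (R T)) →
          (∀ i, (G.augment obj).averagePayment d α T μ x i
              ≤ 7 * lamStar * N ^ (4 / 3 : ℝ) * ε ^ (1 / 3 : ℝ)) ∧
          (G.augment obj).directnessGap d T x
              ≤ 7 * lamStar * N ^ (4 / 3 : ℝ) * ε ^ (1 / 3 : ℝ) ∧
          ∀ μStar, (G.augment obj).IsOptimal d μStar →
            (G.augment obj).optimalityGap d μStar T μ x
              ≤ 7 * lamStar * N ^ (4 / 3 : ℝ) * ε ^ (1 / 3 : ℝ) := by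
  have hdX : d ∈ (G.augment obj).XX := fun i => hd i ▸ EFG.seqForm_mem_X _
  have heq := EFG.exists_isEquilibrium hrecall hs hd
  obtain ⟨μ₀, hμ₀⟩ := EFG.exists_isOptimal heq
  refine ⟨⟨μ₀, hμ₀⟩, EFG.exists_isLagrangeThreshold hdX heq, ?_⟩
  intro L hL hthr R₀ R T N ε α lam hN hε hε0 hα hlam hαN alg μ x hrun hmed hpl
  -- For `T = 0` division by zero would make `ε = 0`.
  have hT : 0 < T := by
    rcases Nat.eq_zero_or_pos T with rfl | hT
    · simp [hε] at hε0
    · exact hT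
  have hN0 : 0 < N := by
    rw [hN]
    exact_mod_cast Fintype.card_pos (α := (G.augment obj).Z)
  -- Cube roots of `ε` and `N` turn all the exponents into integers; κ is `a * b`, and `α ≤ 1 / N`
  -- says exactly that κ ≤ 1.
  obtain ⟨a, ha, haε⟩ : ∃ a : ℝ, 0 < a ∧ a = ε ^ (1 / 3 : ℝ) := ⟨_, by positivity, rfl⟩
  obtain ⟨b, hb, hbN⟩ : ∃ b : ℝ, 0 < b ∧ b = N ^ (1 / 3 : ℝ) := ⟨_, by positivity, rfl⟩
  have ea : ε = a ^ 3 := by rw [haε, ← Real.rpow_mul_natCast hε0.le]; norm_num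
  have eb : N = b ^ 3 := by rw [hbN, ← Real.rpow_mul_natCast hN0.le]; norm_num
  have ea2 : ε ^ (2 / 3 : ℝ) = a ^ 2 := by
    rw [haε, ← Real.rpow_mul_natCast hε0.le]; norm_num
  have eb2 : N ^ (2 / 3 : ℝ) = b ^ 2 := by
    rw [hbN, ← Real.rpow_mul_natCast hN0.le]; norm_num
  have eb4 : N ^ (4 / 3 : ℝ) = b ^ 4 := by
    rw [hbN, ← Real.rpow_mul_natCast hN0.le]; norm_num
  have ea' : ε ^ (-1 / 3 : ℝ) = a⁻¹ := by rw [haε, ← Real.rpow_neg hε0.le]; norm_num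
  have eb' : N ^ (-1 / 3 : ℝ) = b⁻¹ := by rw [hbN, ← Real.rpow_neg hN0.le]; norm_num
  rw [ea2, eb'] at hα
  rw [eb2, ea'] at hlam
  have hα' : α = (a * b) ^ 2 / N := by rw [hα, eb]; field_simp
  have hlam' : lam = N / (a * b) := by rw [hlam, eb]; field_simp
  have hκ1 : a * b ≤ 1 := by
    rw [hα', div_le_div_iff_of_pos_right hN0] at hαN
    exact (sq_le_one_iff₀ (by positivity)).1 hαN
  have hΓ : ∀ k z, (G.augment obj).payoff k z ∈ Set.Icc (0 : ℝ) 1 := fun k z =>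
    augmentTree_payoff_mem G.tree obj [] (fun _ => []) ∅ (fun z i => hu i z) hobj k z
  have hε' : (R₀ T + 4 * n * R T) / T = (a * b) ^ 3 / N := by
    rw [← hε, ea, eb]
    field_simp
  have key := fun μStar hopt => EFG.online_steer_bounds (μStar := μStar) hΓ hd
    (fun ν _ => EFG.exists_isBestResponse_deficit_le hs hd ν) hL hthr hN hT (mul_pos ha hb) hκ1
    hα' hlam' hε' hrun.mediator_mem hrun.players_mem hmed hpl hopt
  have e : 7 * L * N ^ (4 / 3 : ℝ) * ε ^ (1 / 3 : ℝ) = 7 * L * (N * (a * b)) := by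
    rw [eb4, ← haε, eb]
    ring
  rw [e]
  exact ⟨(key μ₀ hμ₀).1, (key μ₀ hμ₀).2.1, fun μStar hopt => (key μStar hopt).2.2⟩
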